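/- **Definitions.** A *point-line geometry* consists of points, lines and an incidence relation between them. A *subspace* is a set of points that contains all points of each line having at least two points in it. A set $X$ of points *generates* the geometry if the smallest subspace containing $X$ is the whole point set, and the *generating rank* is the least cardinality of a generating set of points. For a division ring $K$, let $A_n(K)$ be the geometry whose elements of type $i\in\{1,\dots,n\}$ are the $i$-dimensional subspaces of the right vector space $K^{n+1}$, incidence being symmetrized inclusion; its diagram $A_n$ is the path $1 - 2 - \cdots - n$. For a (commutative) field $K$ and $n\ge 3$, let $q(x)=x_1x_2+x_3x_4+\dots+x_{2n-1}x_{2n}$ on $K^{2n}$. The $n$-dimensional subspaces that are totally singular for $q$ fall into two classes $\mathfrak S^+,\mathfrak S^-$, where $X,Y$ are in the same class if and only if $X\cap Y$ has even codimension in $X$. Let $D_n(K)$ be the geometry whose elements of type $i\in\{1,\dots,n-2\}$ are the $i$-dimensional totally singular subspaces, and whose elements of type $+$ and $-$ are the members of $\mathfrak S^+$ and $\mathfrak S^-$. An element $X$ of type $+$ and an element $Y$ of type $-$ are incident if and only if $\dim(X\cap Y)=n-1$; in all other cases incidence is symmetrized inclusion. In the diagram $D_n$, the nodes $1,\dots,n-2$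 form a path in this order, $+$ and $-$ are both joined to $n-2$, and there are no other edges. Let $X_n$ be $A_n$ or $D_n$. A *flag* of $X_n(K)$ is a set of pairwise incident elements, and its type is the set of the types of its elements. For a set $J$ of nodes, the *$J$-Grassmannian* $\mathrm{Gr}_J(X_n(K))$ is the point-line geometry whose points are the flags of type $J$ and whose lines are the flags of type $(J\setminus\{j\})\cup\mathrm{fr}(j)$ with $j\in J$, where $\mathrm{fr}(j)$ is the set of nodes adjacent to $j$; a point and a line are incident if and only if their union is a flag. The set $J$ is *non-connected* if some two of its nodes are not joined by a path of the diagram inside $J$. A division ring is *finitely generated* if it is generated, as a division ring, by a finite subset. **Lemma.** Let $K$ be a division ring that is not finitely generated. 1. For every $n$ and every non-connected set $J$ of nodes of the diagram $A_n$, the generating rank of $\mathrm{Gr}_J(A_n(K))$ is infinite. 2. If $K$ is commutative, then for every $n\ge 3$ and every non-connected set $J$ of nodes of the diagram $D_n$, the generating rank of $\mathrm{Gr}_J(D_n(K))$ is infinite. -/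

import Mathlib

open Module

universe u v

/-! ### Point-line geometries -/

/-- A point-line geometry: points, lines, and an incidence relation between them. -/
structure PointLineGeometry where
  Point : Type u
  Line : Type v
  Inc : Point → Line → Prop

namespace PointLineGeometry

variable (Γ : PointLineGeometry.{u, v})

/-- A set of points is a subspace if it contains all points of every line that has at least two
(distinct) points in it. -/
def IsSubspace (S : Set Γ.Point) : Prop :=
  ∀ (l : Γ.Line) (p q : Γ.Point), p ∈ S → q ∈ S → p ≠ q → Γ.Inc p l → Γ.Inc q l →
    ∀ r : Γ.Point, Γ.Inc r l → r ∈ S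

/-- The subspace generated by a set of points: the smallest subspace containing it. -/
def span (X : Set Γ.Point) : Set Γ.Point := ⋂₀ {S | Γ.IsSubspace S ∧ X ⊆ S}

/-- The generating rank: the least cardinality of a set of points that generates the geometry.
The set of cardinals below is never empty, as the set of all points generates. -/
noncomputable def generatingRank : Cardinal.{u} :=
  sInf {c | ∃ X : Set Γ.Point, Γ.span X = Set.univ ∧ Cardinal.mk X = c}

end PointLineGeometry

/-! ### Incidence geometries with types, flags and Grassmannians -/

/-- An incidence geometry over a set `T` of types: distinct elements of the same type are never
incident. -/
structure IncidenceGeometry (T : Type v) where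
  Elem : Type u
  type : Elem → T
  Inc : Elem → Elem → Prop
  inc_refl : ∀ x, Inc x x
  inc_symm : ∀ x y, Inc x y → Inc y x
  eq_of_inc : ∀ x y, Inc x y → type x = type y → x = y

namespace IncidenceGeometry

variable {T : Type v} (Δ : IncidenceGeometry.{u, v} T)

/-- A flag: a set of pairwise incident elements. -/
def IsFlag (F : Set Δ.Elem) : Prop := ∀ x ∈ F, ∀ y ∈ F, Δ.Inc x y

/-- A flag of type `J`: the set of the types of its elements is `J`. -/
def IsFlagOfType (J : Set T) (F : Set Δ.Elem) : Prop := Δ.IsFlag F ∧ Δ.type '' F = J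

/-- The `J`-Grassmannian, as a point-line geometry, of a geometry `Δ` with diagram `D`. Its points
are the `J`-flags, its lines are the flags of type `(J \ {j}) ∪ fr(j)` for `j ∈ J`, where `fr(j)` is
the set of the types adjacent to `j` in the diagram. A point and a line are incident when they are
incident as flags, that is when their union is a flag. -/
def grassmannian (D : SimpleGraph T) (J : Set T) : PointLineGeometry.{u, u} where
  Point := {F : Set Δ.Elem // Δ.IsFlagOfType J F}
  Line := {L : Set Δ.Elem // ∃ j ∈ J, Δ.IsFlagOfType ((J \ {j}) ∪ D.neighborSet j) L}
  Inc P L := Δ.IsFlag (P.1 ∪ L.1)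

end IncidenceGeometry

/-! ### Division rings and sets of nodes -/

/-- A division ring is finitely generated if some finite subset generates it as a division ring
(`Subfield` is Mathlib's name for sub-division rings). -/
def IsFinitelyGeneratedDivisionRing (K : Type u) [DivisionRing K] : Prop :=
  ∃ X : Set K, X.Finite ∧ Subfield.closure X = ⊤

/-- A set of nodes of a diagram is connected if any two of its nodes are joined by a path of the
diagram inside the set. The empty set is connected in this sense. -/
def IsConnectedNodeSet {T : Type v} (D : SimpleGraph T) (J : Set T) : Prop :=
  (D.induce J).Preconnected

/-! ### The geometry of type `A_n` -/

section TypeA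

variable (n : ℕ) (K : Type u) [DivisionRing K]

/-- The diagram `A_n`: a path. The node labelled `i ∈ {1, …, n}` is `i - 1 : Fin n`. -/
def diagramA : SimpleGraph (Fin n) := SimpleGraph.pathGraph n

/-- The elements of `A_n(K)`: the subspaces of the right `K`-vector space `K ^ (n + 1)` (a right
`K`-module is a module over `Kᵐᵒᵖ`), of dimension `i ∈ {1, …, n}`, which is the type. -/
structure ElemA where
  node : Fin n
  carrier : Submodule Kᵐᵒᵖ (Fin (n + 1) → K)
  finrank_eq : finrank Kᵐᵒᵖ carrier = (node : ℕ) + 1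

instance finite_op_self : Module.Finite Kᵐᵒᵖ K :=
  ⟨⟨{1}, by
    rw [eq_top_iff]
    intro x _
    have h : x = MulOpposite.op x • (1 : K) := by simp
    rw [h]
    exact Submodule.smul_mem _ _ (Submodule.subset_span (by simp))⟩⟩

/-- The geometry `A_n(K)`, where incidence is symmetrized inclusion. -/
def geometryA : IncidenceGeometry.{u, 0} (Fin n) where
  Elem := ElemA n K
  type := ElemA.node
  Inc x y := x.carrier ≤ y.carrier ∨ y.carrier ≤ x.carrier
  inc_refl _ := Or.inl le_rfl
  inc_symm _ _ h := h.symm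
  eq_of_inc := by
    rintro ⟨i, U, hU⟩ ⟨j, W, hW⟩ h (rfl : i = j)
    have hUW : U = W := by
      rcases h with h | h
      · exact Submodule.eq_of_le_of_finrank_eq h (hU.trans hW.symm)
      · exact (Submodule.eq_of_le_of_finrank_eq h (hW.trans hU.symm)).symm
    subst hUW
    rfl

end TypeA

/-! ### The geometry of type `D_n` -/

/-- The nodes `1, …, n - 2, +, -` of the diagram `D_n`; the node labelled `i ∈ {1, …, n - 2}`
is `low (i - 1)`. -/
inductive NodeD (n : ℕ) where
  | low (i : Fin (n - 2))
  | plus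
  | minus

/-- Adjacency in the diagram `D_n`: the nodes `1, …, n - 2` form a path in this order, and both `+`
and `-` are joined to `n - 2` and to no other node. -/
def adjD (n : ℕ) : NodeD n → NodeD n → Prop
  | .low i, .low j => (i : ℕ) + 1 = j ∨ (j : ℕ) + 1 = i
  | .low i, .plus => (i : ℕ) + 1 = n - 2
  | .low i, .minus => (i : ℕ) + 1 = n - 2
  | .plus, .low i => (i : ℕ) + 1 = n - 2
  | .minus, .low i => (i : ℕ) + 1 = n - 2
  | .plus, .plus => False
  | .plus, .minus => False
  | .minus, .plus => False
  | .minus, .minus => False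

/-- The diagram `D_n` (for `n ≥ 3`). -/
def diagramD (n : ℕ) : SimpleGraph (NodeD n) where
  Adj := adjD n
  symm := ⟨by
    rintro (i | _ | _) (j | _ | _) h <;> simp only [adjD] at h ⊢ <;> first | exact h | exact h.symm⟩
  loopless := ⟨by
    rintro (i | _ | _) h <;> simp [adjD] at h⟩

section TypeD

variable (n : ℕ) (K : Type u) [Field K]

/-- The quadratic form `q(x) = x₁ x₂ + x₃ x₄ + ⋯ + x₂ₙ₋₁ x₂ₙ` of Witt index `n` on `K ^ (2 n)`.
The coordinates are indexed by pairs: `x (i, 0)` and `x (i, 1)` are multiplied with each other. -/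
noncomputable def quadD : QuadraticForm K (Fin n × Fin 2 → K) :=
  ∑ i : Fin n, QuadraticMap.linMulLin
    (LinearMap.proj (i, 0) : (Fin n × Fin 2 → K) →ₗ[K] K) (LinearMap.proj (i, 1))

variable {n K} in
/-- A subspace is totally singular if the quadratic form vanishes on it. -/
def IsTotallySingular (M : Submodule K (Fin n × Fin 2 → K)) : Prop := ∀ x ∈ M, quadD n K x = 0

/-- The totally singular subspace of dimension `n` given by `x (i, 1) = 0` for all `i`. -/
def baseD : Submodule K (Fin n × Fin 2 → K) where
  carrier := {x | ∀ i, x (i, 1) = 0}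
  zero_mem' _ := rfl
  add_mem' {x y} hx hy i := by simp [hx i, hy i]
  smul_mem' c x hx i := by simp [hx i]

/-- Two `n`-dimensional totally singular subspaces are in the same one of the two classes if their
intersection has even codimension in them. The class of type `+` is the one that contains `baseD`. -/
def IsPlusClass (M : Submodule K (Fin n × Fin 2 → K)) : Prop :=
  Even (n - finrank K ↥(M ⊓ baseD n K))

/-- The condition on a totally singular subspace to be an element of a given type. -/
def HasTypeD (M : Submodule K (Fin n × Fin 2 → K)) : NodeD n → Prop
  | .low i => finrank K M = (i : ℕ) + 1
  | .plus => finrank K M = n ∧ IsPlusClass n K M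
  | .minus => finrank K M = n ∧ ¬ IsPlusClass n K M

/-- The elements of `D_n(K)`: the totally singular subspaces of dimension `i ∈ {1, …, n - 2}`, of
type `i`, and those of dimension `n`, of type `+` or `-` according to their class. -/
structure ElemD where
  node : NodeD n
  carrier : Submodule K (Fin n × Fin 2 → K)
  singular : IsTotallySingular carrier
  hasType : HasTypeD n K carrier node

variable {n K} in
/-- Incidence in `D_n(K)`: an element of type `+` and one of type `-` are incident when their
intersection has dimension `n - 1`; otherwise incidence is symmetrized inclusion. -/
def IncD (x y : ElemD n K) : Prop :=
  match x.node, y.node with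
  | .plus, .minus => finrank K ↥(x.carrier ⊓ y.carrier) = n - 1
  | .minus, .plus => finrank K ↥(x.carrier ⊓ y.carrier) = n - 1
  | _, _ => x.carrier ≤ y.carrier ∨ y.carrier ≤ x.carrier

/-- The geometry `D_n(K)` (for `n ≥ 3`). -/
def geometryD : IncidenceGeometry.{u, 0} (NodeD n) where
  Elem := ElemD n K
  type := ElemD.node
  Inc := IncD
  inc_refl := by
    rintro ⟨_ | _ | _, U, hs, hU⟩ <;> exact Or.inl le_rfl
  inc_symm := by
    rintro ⟨_ | _ | _, U, hs, hU⟩ ⟨_ | _ | _, W, ht, hW⟩ h <;>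
      simp only [IncD] at h ⊢ <;> first | exact h.symm | (rw [inf_comm]; exact h)
  eq_of_inc := by
    rintro ⟨i, U, hs, hU⟩ ⟨j, W, ht, hW⟩ h (rfl : i = j)
    have hfin : finrank K U = finrank K W := by
      cases i with
      | low i => exact Eq.trans hU (Eq.symm hW)
      | plus => exact hU.1.trans hW.1.symm
      | minus => exact hU.1.trans hW.1.symm
    have hinc : U ≤ W ∨ W ≤ U := by
      cases i <;> exact h
    have hUW : U = W := by
      rcases hinc with h | h
      · exact Submodule.eq_of_le_of_finrank_eq h hfin
      · exact (Submodule.eq_of_le_of_finrank_eq h hfin.symm).symm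
    subst hUW
    rfl

end TypeD

/-! ### Generating rank and subspaces of Grassmannians. -/

namespace PointLineGeometry

/-! It suffices to enclose every finite set of `J`-flags in a proper subspace. Non-connectedness
provides two distinct non-adjacent nodes i, j of `J`. The type-i elements of finitely many flags
have spanning vectors whose coordinates generate a division subring K₀; it is proper because K is
not finitely generated (`exists_subfield_isRational`), and these elements are rational over K₀.
Rationality, phrased as stability under K₀-linear functionals applied coordinatewise, is inherited
by sums and intersections, and by orthogonal complements in type D.

If x of type i should lie in y of type j, consider the flags for which a K₀-rational U satisfies x ≤
U ≤ y. On a line that varies x, two distinct x₁, x₂ span a subspace containing every other x, and U₁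
+ U₂ serves; on a line that varies y, U₁ ∩ U₂ serves. So these flags form a subspace. It is proper:
for a outside K₀ there is a maximal flag whose members contain e₀ + a e₁ and satisfy the equation x₁
= a x₀, and a functional killing 1 but not a maps that vector outside the equation.

For the nodes + and - of D_n there is no inclusion to interpolate. The replacement is
`RationalPairD`: M or N is rational, or M ∩ N contains a rational subspace of dimension n - 2. That
this passes along lines (`RationalPairD.of_line`) rests on `IsRational.of_hyperplane`: a rational W
of dimension n - 1 makes each maximal totally singular M above it rational. The reason is that W^⊥/W
is a hyperbolic plane with two singular points; one comes from a standard rational maximal subspace,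
so the other is rational too. -/

theorem aleph0_le_generatingRank (Γ : PointLineGeometry.{u, v})
    (h : ∀ X : Set Γ.Point, X.Finite → ∃ S, Γ.IsSubspace S ∧ X ⊆ S ∧ S ≠ Set.univ) :
    Cardinal.aleph0 ≤ Γ.generatingRank := by
  have hne : {c | ∃ X : Set Γ.Point, Γ.span X = Set.univ ∧ Cardinal.mk X = c}.Nonempty :=
    ⟨_, Set.univ, Set.eq_univ_of_univ_subset (Set.subset_sInter fun S hS => hS.2), rfl⟩
  obtain ⟨X, hX, hc⟩ := csInf_mem hne
  by_contra hlt
  rw [not_le, generatingRank, ← hc, Cardinal.lt_aleph0_iff_set_finite] at hlt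
  obtain ⟨S, hS, hXS, hne⟩ := h X hlt
  exact hne (Set.eq_univ_of_univ_subset (hX ▸ Set.sInter_subset_of_mem ⟨hS, hXS⟩))

end PointLineGeometry

namespace IncidenceGeometry

variable {T : Type v} {Δ : IncidenceGeometry.{u, v} T} {D : SimpleGraph T} {J : Set T}

theorem IsFlagOfType.exists_mem {F : Set Δ.Elem} (hF : Δ.IsFlagOfType J F) {i : T} (hi : i ∈ J) :
    ∃ x ∈ F, Δ.type x = i := by
  rw [← hF.2] at hi
  exact hi

theorem IsFlag.eq_of_type_eq {F : Set Δ.Elem} (hF : Δ.IsFlag F) {x y : Δ.Elem} (hx : x ∈ F)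
    (hy : y ∈ F) (h : Δ.type x = Δ.type y) : x = y :=
  Δ.eq_of_inc x y (hF x hx y hy) h

/-- Two points of a line of the `J`-Grassmannian that share their element of the type `j` that the
line varies are equal. -/
theorem point_subset_of_common_line {P Q L : Set Δ.Elem} (hP : Δ.IsFlagOfType J P)
    (hQ : Δ.IsFlagOfType J Q) {j : T} (hL : Δ.IsFlagOfType ((J \ {j}) ∪ D.neighborSet j) L)
    (hPL : Δ.IsFlag (P ∪ L)) (hQL : Δ.IsFlag (Q ∪ L)) {x : Δ.Elem} (hxP : x ∈ P) (hxQ : x ∈ Q)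
    (hx : Δ.type x = j) : P ⊆ Q := by
  intro y hy
  by_cases hyj : Δ.type y = j
  · rwa [hP.1.eq_of_type_eq hy hxP (hyj.trans hx.symm)]
  · have hyJ : Δ.type y ∈ J := by
      rw [← hP.2]
      exact ⟨y, hy, rfl⟩
    obtain ⟨l, hl, hlt⟩ := hL.exists_mem (Or.inl ⟨hyJ, hyj⟩)
    obtain ⟨z, hz, hzt⟩ := hQ.exists_mem hyJ
    rw [hPL.eq_of_type_eq (Or.inl hy) (Or.inr hl) hlt.symm,
      ← hQL.eq_of_type_eq (Or.inl hz) (Or.inr hl) (hzt.trans hlt.symm)]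
    exact hz

/-- The set of the `J`-flags whose elements `x`, `y` of types `i`, `j` satisfy `G x y`. -/
def flagsWith (Δ : IncidenceGeometry.{u, v} T) (D : SimpleGraph T) (J : Set T) (i j : T)
    (G : Δ.Elem → Δ.Elem → Prop) : Set (Δ.grassmannian D J).Point :=
  {P | ∃ x ∈ P.1, ∃ y ∈ P.1, Δ.type x = i ∧ Δ.type y = j ∧ G x y}

/-- All points of a line share their elements of every type in `J` except the one type m that the
line varies. So `G` needs checking only for m = i and m = j; there the line supplies an element z of
an adjacent type, incident with everything involved, and distinct points have distinct elements of
type m. -/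
theorem isSubspace_flagsWith {i j i' j' : T} (hi : i ∈ J) (hj : j ∈ J) (hij : i ≠ j)
    (hi' : D.Adj i i') (hj' : D.Adj j j') (G : Δ.Elem → Δ.Elem → Prop)
    (h₁ : ∀ x₁ x₂ x₃ y z, Δ.type x₁ = i → Δ.type x₂ = i → Δ.type x₃ = i → Δ.type y = j →
      Δ.type z = i' → x₁ ≠ x₂ → Δ.Inc x₁ z → Δ.Inc x₂ z → Δ.Inc x₃ z → Δ.Inc y z →
      Δ.Inc x₁ y → Δ.Inc x₂ y → Δ.Inc x₃ y → G x₁ y → G x₂ y → G x₃ y)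
    (h₂ : ∀ y₁ y₂ y₃ x z, Δ.type y₁ = j → Δ.type y₂ = j → Δ.type y₃ = j → Δ.type x = i →
      Δ.type z = j' → y₁ ≠ y₂ → Δ.Inc y₁ z → Δ.Inc y₂ z → Δ.Inc y₃ z → Δ.Inc x z →
      Δ.Inc x y₁ → Δ.Inc x y₂ → Δ.Inc x y₃ → G x y₁ → G x y₂ → G x y₃) :
    (Δ.grassmannian D J).IsSubspace (Δ.flagsWith D J i j G) := by
  rintro ⟨L, m, hm, hL⟩ ⟨P, hP⟩ ⟨Q, hQ⟩ ⟨x₁, hx₁, y₁, hy₁, hx₁i, hy₁j, hG₁⟩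
    ⟨x₂, hx₂, y₂, hy₂, hx₂i, hy₂j, hG₂⟩ hPQ hPL hQL ⟨R, hR⟩ hRL
  change Δ.IsFlag (P ∪ L) at hPL
  change Δ.IsFlag (Q ∪ L) at hQL
  change Δ.IsFlag (R ∪ L) at hRL
  change x₁ ∈ P at hx₁
  change y₁ ∈ P at hy₁
  change x₂ ∈ Q at hx₂
  change y₂ ∈ Q at hy₂
  obtain ⟨x₃, hx₃, hx₃i⟩ := hR.exists_mem hi
  obtain ⟨y₃, hy₃, hy₃j⟩ := hR.exists_mem hj
  refine ⟨x₃, hx₃, y₃, hy₃, hx₃i, hy₃j, ?_⟩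
  have common : ∀ {t}, t ∈ J → t ≠ m → ∀ {F : Set Δ.Elem}, Δ.IsFlag (F ∪ L) →
      ∀ {F' : Set Δ.Elem}, Δ.IsFlag (F' ∪ L) → ∀ {a b}, a ∈ F → b ∈ F' → Δ.type a = t →
      Δ.type b = t → a = b := by
    intro t ht htm F hF F' hF' a b ha hb hat hbt
    obtain ⟨l, hl, hlt⟩ := hL.exists_mem (Or.inl ⟨ht, htm⟩)
    rw [hF.eq_of_type_eq (Or.inl ha) (Or.inr hl) (hat.trans hlt.symm),
      hF'.eq_of_type_eq (Or.inl hb) (Or.inr hl) (hbt.trans hlt.symm)]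
  have differ : ∀ {a b}, a ∈ P → b ∈ Q → Δ.type a = m → Δ.type b = m → a ≠ b := by
    rintro a _ ha hb hat - rfl
    exact hPQ (Subtype.ext ((point_subset_of_common_line hP hQ hL hPL hQL ha hb hat).antisymm
      (point_subset_of_common_line hQ hP hL hQL hPL hb ha hat)))
  by_cases hmi : m = i
  · subst hmi
    obtain ⟨z, hz, hzt⟩ := hL.exists_mem (Or.inr hi')
    obtain rfl := common hj hij.symm hPL hRL hy₁ hy₃ hy₁j hy₃j
    obtain rfl := common hj hij.symm hQL hRL hy₂ hy₃ hy₂j hy₃j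
    exact h₁ x₁ x₂ x₃ y₂ z hx₁i hx₂i hx₃i hy₂j hzt (differ hx₁ hx₂ hx₁i hx₂i)
      (hPL _ (Or.inl hx₁) _ (Or.inr hz)) (hQL _ (Or.inl hx₂) _ (Or.inr hz))
      (hRL _ (Or.inl hx₃) _ (Or.inr hz)) (hPL _ (Or.inl hy₁) _ (Or.inr hz))
      (hP.1 _ hx₁ _ hy₁) (hQ.1 _ hx₂ _ hy₂) (hR.1 _ hx₃ _ hy₃) hG₁ hG₂
  obtain rfl := common hi (Ne.symm hmi) hPL hRL hx₁ hx₃ hx₁i hx₃i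
  obtain rfl := common hi (Ne.symm hmi) hQL hRL hx₂ hx₃ hx₂i hx₃i
  by_cases hmj : m = j
  · subst hmj
    obtain ⟨z, hz, hzt⟩ := hL.exists_mem (Or.inr hj')
    exact h₂ y₁ y₂ y₃ x₂ z hy₁j hy₂j hy₃j hx₂i hzt (differ hy₁ hy₂ hy₁j hy₂j)
      (hPL _ (Or.inl hy₁) _ (Or.inr hz)) (hQL _ (Or.inl hy₂) _ (Or.inr hz))
      (hRL _ (Or.inl hy₃) _ (Or.inr hz)) (hPL _ (Or.inl hx₁) _ (Or.inr hz))
      (hP.1 _ hx₁ _ hy₁) (hQ.1 _ hx₂ _ hy₂) (hR.1 _ hx₃ _ hy₃) hG₁ hG₂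
  · obtain rfl := common hj (Ne.symm hmj) hPL hRL hy₁ hy₃ hy₁j hy₃j
    exact hG₁

/-- Here `c` is a maximal flag with one element of each type; its part of type `J` is the omitted
point. -/
theorem flagsWith_ne_univ (c : T → Δ.Elem) (hc : ∀ t, Δ.type (c t) = t)
    (hinc : ∀ s t, Δ.Inc (c s) (c t)) {i j : T} {G : Δ.Elem → Δ.Elem → Prop}
    (hG : ¬ G (c i) (c j)) : Δ.flagsWith D J i j G ≠ Set.univ := by
  intro h
  have hP : Δ.IsFlagOfType J (c '' J) := by
    refine ⟨?_, by simp [Set.image_image, hc]⟩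
    rintro _ ⟨s, -, rfl⟩ _ ⟨t, -, rfl⟩
    exact hinc s t
  obtain ⟨_, ⟨s, -, rfl⟩, _, ⟨t, -, rfl⟩, hs, ht, hst⟩ :
      (⟨c '' J, hP⟩ : (Δ.grassmannian D J).Point) ∈ Δ.flagsWith D J i j G := h ▸ trivial
  rw [hc] at hs ht
  subst hs ht
  exact hG hst

end IncidenceGeometry

theorem exists_not_adj_of_not_isConnectedNodeSet {T : Type v} {D : SimpleGraph T} {J : Set T}
    (h : ¬ IsConnectedNodeSet D J) : ∃ i ∈ J, ∃ j ∈ J, i ≠ j ∧ ¬ D.Adj i j := by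
  by_contra! hJ
  refine h fun i j => ?_
  by_cases hij : i = j
  · rw [hij]
  · exact SimpleGraph.Adj.reachable
      (hJ i i.2 j j.2 fun h => hij (Subtype.ext h) : D.Adj i j)

/-! ### Rational subspaces -/

section Rational

variable {K : Type u} [DivisionRing K] {ι : Type*} {R : Type*} [Ring R] [Module R K]

/-- A subspace of `K ^ ι` is rational over a division subring `K₀` if it is stable under the
coordinatewise application of the left `K₀`-linear functionals `K → K₀`; that is, if it is spanned
by vectors with coordinates in `K₀`. -/
def IsRational (K₀ : Subfield K) (U : Submodule R (ι → K)) : Prop :=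
  ∀ φ : K →ₗ[K₀] K₀, ∀ v ∈ U, (fun i => (φ (v i) : K)) ∈ U

variable {K₀ : Subfield K}

theorem IsRational.inf {U W : Submodule R (ι → K)} (hU : IsRational K₀ U) (hW : IsRational K₀ W) :
    IsRational K₀ (U ⊓ W) :=
  fun φ v hv => ⟨hU φ v hv.1, hW φ v hv.2⟩

theorem IsRational.sup {U W : Submodule R (ι → K)} (hU : IsRational K₀ U) (hW : IsRational K₀ W) :
    IsRational K₀ (U ⊔ W) := by
  intro φ v hv
  obtain ⟨u, hu, w, hw, rfl⟩ := Submodule.mem_sup.1 hv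
  have : (fun i => (φ ((u + w) i) : K)) = (fun i => (φ (u i) : K)) + fun i => (φ (w i) : K) := by
    ext i
    simp
  rw [this]
  exact Submodule.add_mem_sup (hU φ u hu) (hW φ w hw)

/-- If v has coordinates in K₀, left linearity gives φ(vᵢ) = vᵢ φ(1), so applying φ multiplies v on
the right by φ(1). The ring `R` stands for the right scalars: `Kᵐᵒᵖ` in type A, `K` itself in type
D. -/
theorem isRational_span [SMulCommClass R K₀ K] (hR : ∀ c : K, ∃ r : R, ∀ k : K, r • k = k * c)
    {s : Set (ι → K)} (hs : ∀ v ∈ s, ∀ i, v i ∈ K₀) : IsRational K₀ (Submodule.span R s) := by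
  intro φ v hv
  induction hv using Submodule.span_induction generalizing φ with
  | mem v hv =>
    obtain ⟨r, hr⟩ := hR (φ 1)
    have : (fun i => (φ (v i) : K)) = r • v := by
      ext i
      have h := φ.map_smul (⟨v i, hs v hv i⟩ : K₀) 1
      rw [Pi.smul_apply, hr, show v i = (⟨v i, hs v hv i⟩ : K₀) • (1 : K) by
        simp [Subfield.smul_def], h]
      simp [Subfield.smul_def]
    rw [this]
    exact Submodule.smul_mem _ _ (Submodule.subset_span hv)
  | zero =>
    convert! (Submodule.span R s).zero_mem using 1
    ext i
    simp
  | add u w _ _ hu hw =>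
    convert! Submodule.add_mem _ (hu φ) (hw φ) using 1
    ext i
    simp
  | smul r v _ hv =>
    -- A right scalar commutes with left K₀-multiplication, so it is absorbed into the functional;
    -- hence the induction runs over all φ at once.
    exact hv (φ ∘ₗ { toFun := fun k => r • k
                     map_add' := smul_add r
                     map_smul' := fun c k => smul_comm r c k })

/-- The coordinates of finite spanning sets of finitely many subspaces form a finite set, so the
division subring they generate cannot be all of K. -/
theorem exists_subfield_isRational [Finite ι] [∀ K₀ : Subfield K, SMulCommClass R K₀ K]
    (hR : ∀ c : K, ∃ r : R, ∀ k : K, r • k = k * c) (hK : ¬ IsFinitelyGeneratedDivisionRing K)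
    {𝒰 : Set (Submodule R (ι → K))} (hfin : 𝒰.Finite) (h𝒰 : ∀ U ∈ 𝒰, U.FG) :
    ∃ K₀ : Subfield K, K₀ ≠ ⊤ ∧ ∀ U ∈ 𝒰, IsRational K₀ U := by
  choose! s hs using h𝒰
  let X : Set K := ⋃ U ∈ 𝒰, ⋃ v ∈ s U, Set.range v
  refine ⟨Subfield.closure X, fun h => hK ⟨X, ?_, h⟩, fun U hU => ?_⟩
  · exact hfin.biUnion fun U _ => (s U).finite_toSet.biUnion fun v _ => Set.finite_range v
  · rw [← hs U hU]
    refine isRational_span hR fun v hv i => Subfield.subset_closure ?_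
    simp only [X, Set.mem_iUnion]
    exact ⟨U, hU, v, hv, i, rfl⟩

/-- A functional that separates a scalar outside `K₀` from `1`. -/
theorem exists_functional_eq_one {a : K} (ha : a ∉ K₀) :
    ∃ φ : K →ₗ[K₀] K₀, φ 1 = 0 ∧ φ a = 1 := by
  have hmem : a ∉ Submodule.span K₀ {(1 : K)} := by
    rw [Submodule.mem_span_singleton]
    rintro ⟨c, rfl⟩
    exact ha (by simp [Subfield.smul_def])
  obtain ⟨f, hf, hker⟩ := Submodule.exists_le_ker_of_notMem hmem
  refine ⟨(LinearMap.toSpanSingleton K₀ K₀ (f a)⁻¹) ∘ₗ f, ?_, ?_⟩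
  · have : f 1 = 0 := hker (Submodule.mem_span_singleton_self 1)
    simp [this]
  · simp [hf]

end Rational

/-! ### Hyperplanes of finite-dimensional subspaces -/

section Dimension

variable {R V : Type*} [DivisionRing R] [AddCommGroup V] [Module R V] [Module.Finite R V]
  {X Y Z : Submodule R V} {k : ℕ}

theorem le_sup_of_finrank_succ (hX : X ≤ Z) (hY : Y ≤ Z) (hXk : finrank R X = k)
    (hYk : finrank R Y = k) (hZ : finrank R Z = k + 1) (hXY : X ≠ Y) : Z ≤ X ⊔ Y := by
  refine (Submodule.eq_of_le_of_finrank_le (sup_le hX hY) ?_).ge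
  rw [hZ, Nat.succ_le_iff, ← hXk]
  refine Submodule.finrank_lt_finrank_of_lt (left_lt_sup.2 fun h => hXY ?_)
  exact (Submodule.eq_of_le_of_finrank_eq h (hYk.trans hXk.symm)).symm

theorem finrank_inf_lt (hXk : finrank R X = k) (hYk : finrank R Y = k) (hXY : X ≠ Y) :
    finrank R ↥(X ⊓ Y) < k := by
  rw [← hXk]
  refine Submodule.finrank_lt_finrank_of_lt (inf_lt_left.2 fun h => hXY ?_)
  exact Submodule.eq_of_le_of_finrank_eq h (hXk.trans hYk.symm)

theorem inf_le_of_finrank_le (hX : Z ≤ X) (hY : Z ≤ Y)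
    (h : finrank R ↥(X ⊓ Y) ≤ finrank R Z) : X ⊓ Y ≤ Z :=
  (Submodule.eq_of_le_of_finrank_le (le_inf hX hY) h).ge

end Dimension

/-! ### Type A: the invariant subspace of flags and a flag outside it. -/

section TypeA

variable {n : ℕ} {K : Type u} [DivisionRing K]

theorem ElemA.le_of_inc {x y : ElemA n K} (h : (geometryA n K).Inc x y)
    (hxy : x.node ≤ y.node) : x.carrier ≤ y.carrier := by
  rcases h with h | h
  · exact h
  · refine (Submodule.eq_of_le_of_finrank_le h ?_).ge
    rw [x.finrank_eq, y.finrank_eq]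
    exact Nat.succ_le_succ hxy

/-- Some rational subspace lies between the elements `x` and `y` of `A_n(K)`. -/
def RationalBetweenA (K₀ : Subfield K) (x y : (geometryA n K).Elem) : Prop :=
  ∃ U, IsRational K₀ U ∧ ElemA.carrier x ≤ U ∧ U ≤ ElemA.carrier y

/-- Varying x: x₃ ≤ z = x₁ + x₂ ≤ U₁ + U₂. Varying y, dually: U₁ ∩ U₂ ≤ y₁ ∩ y₂ = z ≤ y₃. -/
theorem isSubspace_rationalBetweenA (K₀ : Subfield K) {J : Set (Fin n)} {i j : Fin n}
    (hi : i ∈ J) (hj : j ∈ J) (hij : i < j) :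
    ((geometryA n K).grassmannian (diagramA n) J).IsSubspace
      ((geometryA n K).flagsWith (diagramA n) J i j (RationalBetweenA K₀)) := by
  have hij' : (i : ℕ) < j := hij
  let i' : Fin n := ⟨i + 1, by omega⟩
  let j' : Fin n := ⟨j - 1, by omega⟩
  have hi' : (diagramA n).Adj i i' := SimpleGraph.pathGraph_adj.2 (Or.inl rfl)
  have hj' : (diagramA n).Adj j j' := SimpleGraph.pathGraph_adj.2 (Or.inr (by simp [j']; omega))
  refine IncidenceGeometry.isSubspace_flagsWith hi hj hij.ne hi' hj' _ ?_ ?_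
  · rintro (x₁ : ElemA n K) (x₂ : ElemA n K) (x₃ : ElemA n K) (y : ElemA n K) (z : ElemA n K)
      (h₁ : x₁.node = i) (h₂ : x₂.node = i) (h₃ : x₃.node = i) (hy : y.node = j)
      (hz : z.node = i') hne h₁z h₂z h₃z hyz - - - ⟨U₁, hU₁, hxU₁, hUy₁⟩ ⟨U₂, hU₂, hxU₂, hUy₂⟩
    have hiz : i ≤ z.node := by rw [hz]; exact Nat.le_succ _
    have hzx : z.carrier ≤ x₁.carrier ⊔ x₂.carrier := by
      refine le_sup_of_finrank_succ (ElemA.le_of_inc h₁z (h₁ ▸ hiz))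
        (ElemA.le_of_inc h₂z (h₂ ▸ hiz)) (k := i + 1) (by rw [x₁.finrank_eq, h₁])
        (by rw [x₂.finrank_eq, h₂]) (by rw [z.finrank_eq, hz]) fun h => hne ?_
      exact (geometryA n K).eq_of_inc _ _ (Or.inl h.le) (h₁.trans h₂.symm)
    exact ⟨U₁ ⊔ U₂, hU₁.sup hU₂, (ElemA.le_of_inc h₃z (h₃ ▸ hiz)).trans
      (hzx.trans (sup_le_sup hxU₁ hxU₂)), sup_le hUy₁ hUy₂⟩
  · rintro (y₁ : ElemA n K) (y₂ : ElemA n K) (y₃ : ElemA n K) (x : ElemA n K) (z : ElemA n K)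
      (h₁ : y₁.node = j) (h₂ : y₂.node = j) (h₃ : y₃.node = j) (hx : x.node = i)
      (hz : z.node = j') hne h₁z h₂z h₃z hxz - - - ⟨U₁, hU₁, hxU₁, hUy₁⟩ ⟨U₂, hU₂, hxU₂, hUy₂⟩
    have hzj : z.node ≤ j := by rw [hz]; exact Nat.sub_le _ _
    have hle : ∀ {y : ElemA n K}, y.node = j → (geometryA n K).Inc y z →
        z.carrier ≤ y.carrier := fun hy h =>
      ElemA.le_of_inc ((geometryA n K).inc_symm _ _ h) (hy ▸ hzj)
    have hyz : y₁.carrier ⊓ y₂.carrier ≤ z.carrier := by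
      refine inf_le_of_finrank_le (hle h₁ h₁z) (hle h₂ h₂z) ?_
      have := finrank_inf_lt (k := j + 1) (by rw [y₁.finrank_eq, h₁])
        (by rw [y₂.finrank_eq, h₂]) fun h => hne
          ((geometryA n K).eq_of_inc y₁ y₂ (Or.inl h.le) (h₁.trans h₂.symm))
      rw [z.finrank_eq, hz]
      simp only [j']
      omega
    exact ⟨U₁ ⊓ U₂, hU₁.inf hU₂, le_inf hxU₁ hxU₂,
      (inf_le_inf hUy₁ hUy₂).trans (hyz.trans (hle h₃ h₃z))⟩

/-- The basis `e₀ + e₁ a, e₂, …, eₙ` of a hyperplane. -/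
def chainVecA (n : ℕ) (a : K) (k : Fin n) : Fin (n + 1) → K :=
  if (k : ℕ) = 0 then Pi.single 0 1 + Pi.single k.succ a else Pi.single k.succ 1

theorem linearIndependent_chainVecA (a : K) : LinearIndependent Kᵐᵒᵖ (chainVecA n a) := by
  rw [Fintype.linearIndependent_iff]
  intro g hg k
  by_cases hk : (k : ℕ) = 0
  · have h := congrFun hg 0
    rw [Finset.sum_apply, Finset.sum_eq_single k] at h
    · simpa [chainVecA, hk, Fin.succ_ne_zero, Pi.single_apply, (Fin.succ_ne_zero k).symm] using h
    · intro l _ hl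
      have : (l : ℕ) ≠ 0 := fun h => hl (Fin.ext (h.trans hk.symm))
      simp [chainVecA, this, (Fin.succ_ne_zero l).symm]
    · simp
  · have h := congrFun hg k.succ
    rw [Finset.sum_apply, Finset.sum_eq_single k] at h
    · simpa [chainVecA, hk] using h
    · intro l _ hl
      by_cases hl0 : (l : ℕ) = 0 <;>
        simp [chainVecA, hl0, Fin.succ_ne_zero, hl.symm]
    · simp

/-- The members `⟨e₀ + e₁ a, e₂, …, eₖ⟩` of a maximal flag of `A_n(K)`. -/
def chainA (a : K) (m : Fin n) : ElemA n K where
  node := m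
  carrier := Submodule.span Kᵐᵒᵖ
    (Set.range (chainVecA n a ∘ Fin.castLE (Nat.succ_le_of_lt m.2)))
  finrank_eq := by
    rw [finrank_span_eq_card
      ((linearIndependent_chainVecA a).comp _ (Fin.castLE_injective _)), Fintype.card_fin]

theorem chainA_mono (a : K) {l m : Fin n} (h : l ≤ m) :
    (chainA a l).carrier ≤ (chainA a m).carrier := by
  refine Submodule.span_mono ?_
  rintro _ ⟨k, rfl⟩
  exact ⟨Fin.castLE (Nat.succ_le_succ h) k, rfl⟩

/-- The factor a stands on the left, so the equation is preserved by right scalars. -/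
theorem apply_one_of_mem_chainA (a : K) (m : Fin n) {x : Fin (n + 1) → K}
    (hx : x ∈ (chainA a m).carrier) : x (Fin.succ ⟨0, m.pos⟩) = a * x 0 := by
  induction hx using Submodule.span_induction with
  | mem x hx =>
    obtain ⟨k, rfl⟩ := hx
    by_cases hk : (k : ℕ) = 0
    · have : Fin.castLE (Nat.succ_le_of_lt m.2) k = ⟨0, m.pos⟩ := Fin.ext hk
      simp [chainVecA, this]
    · simp [chainVecA, hk, (Fin.succ_ne_zero _).symm, Fin.ext_iff]
  | zero => simp
  | add x y _ _ hx hy => rw [Pi.add_apply, Pi.add_apply, hx, hy, mul_add]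
  | smul r x _ hx =>
    rw [Pi.smul_apply, Pi.smul_apply, hx, MulOpposite.smul_eq_mul_unop,
      MulOpposite.smul_eq_mul_unop, mul_assoc]

theorem not_rationalBetweenA_chainA {K₀ : Subfield K} {a : K} (ha : a ∉ K₀) (i j : Fin n) :
    ¬ RationalBetweenA K₀ (chainA a i) (chainA a j) := by
  rintro ⟨U, hU, hiU, hUj⟩
  obtain ⟨φ, h1, ha⟩ := exists_functional_eq_one ha
  have hv : chainVecA n a ⟨0, i.pos⟩ ∈ U := hiU (Submodule.subset_span ⟨⟨0, by omega⟩, rfl⟩)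
  -- Since φ(1) = 0 and φ(a) = 1, the functional sends e₀ + e₁ a to e₁, which violates x₁ = a x₀.
  have h := apply_one_of_mem_chainA a j (hUj (hU φ _ hv))
  simp [chainVecA, ha, h1] at h

theorem aleph0_le_generatingRank_A (hK : ¬ IsFinitelyGeneratedDivisionRing K) {J : Set (Fin n)}
    {i j : Fin n} (hi : i ∈ J) (hj : j ∈ J) (hij : i < j) :
    Cardinal.aleph0 ≤ ((geometryA n K).grassmannian (diagramA n) J).generatingRank := by
  refine PointLineGeometry.aleph0_le_generatingRank _ fun X hX => ?_
  have hX' : ∀ P : ((geometryA n K).grassmannian (diagramA n) J).Point,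
      ∃ x : ElemA n K, x ∈ P.1 ∧ x.node = i := fun P => P.2.exists_mem hi
  choose c hc hci using hX'
  obtain ⟨K₀, hK₀, hrat⟩ := exists_subfield_isRational (R := Kᵐᵒᵖ) (ι := Fin (n + 1))
    (fun c => ⟨MulOpposite.op c, fun k => rfl⟩) hK (hX.image fun P => (c P).carrier)
    fun U _ => IsNoetherian.noetherian U
  obtain ⟨a, ha⟩ : ∃ a, a ∉ K₀ := by
    by_contra! h
    exact hK₀ (eq_top_iff.2 fun a _ => h a)
  refine ⟨_, isSubspace_rationalBetweenA K₀ hi hj hij, fun P hP => ?_,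
    IncidenceGeometry.flagsWith_ne_univ (chainA a) (fun _ => rfl) (fun l m => ?_)
      (not_rationalBetweenA_chainA ha i j)⟩
  · obtain ⟨y, hy, hyj⟩ := P.2.exists_mem hj
    -- The rational type-i element is itself the interpolating subspace.
    refine ⟨c P, hc P, y, hy, hci P, hyj, _, hrat _ ⟨P, hP, rfl⟩, le_rfl,
      ElemA.le_of_inc (P.2.1 _ (hc P) _ hy) ?_⟩
    rw [hci, show ElemA.node y = j from hyj]
    exact hij.le
  · exact (le_total l m).imp (chainA_mono a) (chainA_mono a)

end TypeA

/-! ### The quadratic space, its polar form and orthogonality. -/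

section QuadraticSpace

variable {n : ℕ} {K : Type u} [Field K]

theorem quadD_apply (x : Fin n × Fin 2 → K) : quadD n K x = ∑ i, x (i, 0) * x (i, 1) := by
  simp [quadD, sum_apply]

/-- The polar form of `quadD`. -/
noncomputable def bilD (n : ℕ) (K : Type u) [Field K] :
    LinearMap.BilinForm K (Fin n × Fin 2 → K) :=
  (quadD n K).polarBilin

theorem bilD_eq (x y : Fin n × Fin 2 → K) :
    bilD n K x y = quadD n K (x + y) - quadD n K x - quadD n K y := rfl

theorem bilD_apply (x y : Fin n × Fin 2 → K) :
    bilD n K x y = ∑ i, (x (i, 0) * y (i, 1) + x (i, 1) * y (i, 0)) := by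
  simp only [bilD_eq, quadD_apply, ← Finset.sum_sub_distrib, Pi.add_apply]
  exact Finset.sum_congr rfl fun i _ => by ring

theorem quadD_add (x y : Fin n × Fin 2 → K) :
    quadD n K (x + y) = quadD n K x + quadD n K y + bilD n K x y := by
  rw [bilD_eq]
  ring

theorem quadD_smul (c : K) (x : Fin n × Fin 2 → K) :
    quadD n K (c • x) = c * c * quadD n K x := by
  simp [QuadraticMap.map_smul]

theorem bilD_comm (x y : Fin n × Fin 2 → K) : bilD n K x y = bilD n K y x := by
  rw [bilD_eq, bilD_eq, add_comm]
  ring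

theorem bilD_self_of_quadD_eq_zero {x : Fin n × Fin 2 → K} (h : quadD n K x = 0) :
    bilD n K x x = 0 := by
  rw [bilD_eq, ← two_smul K x, quadD_smul, h]
  ring

theorem bilD_isSymm : (bilD n K).IsSymm := ⟨fun x y => bilD_comm x y⟩

theorem bilD_nondegenerate : (bilD n K).Nondegenerate := by
  have hr : (bilD n K).IsRefl := bilD_isSymm.isRefl
  refine (LinearMap.IsRefl.nondegenerate_iff_separatingLeft (B := bilD n K) hr).2 fun x hx => ?_
  ext ⟨i, k⟩
  -- In `Fin 2`, `1 - k` is the other index: this is the basis vector paired with coordinate (i, k).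
  have h := hx (Pi.single (i, 1 - k) 1)
  rw [bilD_apply, Finset.sum_eq_single i] at h
  · fin_cases k <;> simpa [Pi.single_apply] using h
  · intro j _ hj
    simp [hj]
  · simp

/-- The subspace of the vectors that are orthogonal to `U`. -/
noncomputable def perpD (U : Submodule K (Fin n × Fin 2 → K)) :
    Submodule K (Fin n × Fin 2 → K) :=
  (bilD n K).orthogonal U

theorem mem_perpD {U : Submodule K (Fin n × Fin 2 → K)} {y : Fin n × Fin 2 → K} :
    y ∈ perpD U ↔ ∀ u ∈ U, bilD n K u y = 0 := Iff.rfl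

theorem perpD_anti {U W : Submodule K (Fin n × Fin 2 → K)} (h : U ≤ W) : perpD W ≤ perpD U :=
  fun _ hy u hu => hy u (h hu)

theorem finrank_perpD (U : Submodule K (Fin n × Fin 2 → K)) :
    finrank K (perpD U) = n * 2 - finrank K U := by
  rw [perpD, LinearMap.BilinForm.finrank_orthogonal bilD_nondegenerate]
  simp

theorem finrank_le_two_mul (U : Submodule K (Fin n × Fin 2 → K)) : finrank K U ≤ n * 2 := by
  simpa using Submodule.finrank_le U

theorem perpD_sup (U W : Submodule K (Fin n × Fin 2 → K)) :
    perpD (U ⊔ W) = perpD U ⊓ perpD W := by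
  refine le_antisymm (le_inf (perpD_anti le_sup_left) (perpD_anti le_sup_right)) ?_
  rintro y ⟨hU, hW⟩ x hx
  obtain ⟨u, hu, w, hw, rfl⟩ := Submodule.mem_sup.1 hx
  change bilD n K (u + w) y = 0
  rw [map_add, LinearMap.add_apply, mem_perpD.1 hU u hu, mem_perpD.1 hW w hw, add_zero]

namespace IsTotallySingular

variable {M N W U : Submodule K (Fin n × Fin 2 → K)}

theorem mono (hM : IsTotallySingular M) (h : W ≤ M) : IsTotallySingular W :=
  fun x hx => hM x (h hx)

theorem le_perpD (hM : IsTotallySingular M) : M ≤ perpD M := by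
  intro y hy x hx
  change bilD n K x y = 0
  rw [bilD_eq, hM _ (M.add_mem hx hy), hM x hx, hM y hy]
  simp

theorem bilD_eq_zero (hM : IsTotallySingular M) {x y : Fin n × Fin 2 → K} (hx : x ∈ M)
    (hy : y ∈ M) : bilD n K x y = 0 := hM.le_perpD hy x hx

theorem perpD_eq (hM : IsTotallySingular M) (hMn : finrank K M = n) : perpD M = M := by
  refine (Submodule.eq_of_le_of_finrank_eq hM.le_perpD ?_).symm
  rw [finrank_perpD]
  omega

theorem sup (hM : IsTotallySingular M) (hN : IsTotallySingular N) (h : N ≤ perpD M) :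
    IsTotallySingular (M ⊔ N) := by
  intro x hx
  obtain ⟨u, hu, w, hw, rfl⟩ := Submodule.mem_sup.1 hx
  rw [quadD_add, hM u hu, hN w hw, mem_perpD.1 (h hw) u hu]
  simp

end IsTotallySingular

/-- A hyperplane of a subspace, together with a further vector of it, spans it. -/
theorem hyperplane_sup_span_singleton {V : Type*} [AddCommGroup V] [Module K V]
    [Module.Finite K V] {W M : Submodule K V} {m : ℕ} (hWM : W ≤ M) (hW : finrank K W + 1 = m)
    (hM : finrank K M = m) {x : V} (hx : x ∈ M) (hxW : x ∉ W) : W ⊔ K ∙ x = M := by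
  refine Submodule.eq_of_le_of_finrank_le
    (sup_le hWM ((Submodule.span_singleton_le_iff_mem _ _).2 hx)) ?_
  rw [hM, ← hW, Nat.succ_le_iff]
  refine Submodule.finrank_lt_finrank_of_lt (left_lt_sup.2 fun h => hxW ?_)
  exact h (Submodule.mem_span_singleton_self x)

/-! ### The standard maximal subspace and the two classes. -/

section Base

theorem isTotallySingular_baseD : IsTotallySingular (baseD n K) := by
  intro x hx
  rw [quadD_apply]
  exact Finset.sum_eq_zero fun i _ => by rw [hx i, mul_zero]

theorem finrank_baseD : finrank K (baseD n K) = n := by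
  let e : baseD n K ≃ₗ[K] (Fin n → K) :=
    { toFun := fun x i => x.1 (i, 0)
      map_add' := fun _ _ => rfl
      map_smul' := fun _ _ => rfl
      invFun := fun y => ⟨fun p => if p.2 = 0 then y p.1 else 0, fun i => by simp⟩
      left_inv := by
        rintro ⟨x, hx⟩
        ext ⟨i, k⟩
        fin_cases k
        · simp
        · simpa using (hx i).symm
      right_inv := fun y => by simp }
  rw [e.finrank_eq, finrank_fin_fun]

theorem isRational_baseD (K₀ : Subfield K) : IsRational K₀ (baseD n K) := by
  intro φ v hv i
  simp [hv i]

end Base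

section Hyperplane

variable {W M N E : Submodule K (Fin n × Fin 2 → K)}

/-- The dimension of `E ∩ W^⊥` for a maximal totally singular `E` and `W` of dimension `n - 1`. -/
theorem finrank_inf_perpD (hE : IsTotallySingular E) (hEn : finrank K E = n)
    (hWn : finrank K W + 1 = n) : finrank K ↥(E ⊓ perpD W) = finrank K ↥(E ⊓ W) + 1 := by
  -- As E = E^⊥, the count is 2n - (n + (n - 1) - dim(E ∩ W)).
  have h : perpD (E ⊔ W) = E ⊓ perpD W := by rw [perpD_sup, hE.perpD_eq hEn]
  have h1 := Submodule.finrank_sup_add_finrank_inf_eq E W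
  have h2 := finrank_perpD (E ⊔ W)
  have h3 := finrank_le_two_mul (E ⊔ W)
  have h4 : finrank K ↥(E ⊓ W) ≤ finrank K W := Submodule.finrank_mono inf_le_right
  rw [h] at h2
  omega

/-- Two maximal totally singular subspaces that meet in a hyperplane belong to different classes. -/
theorem isPlusClass_iff_not (hM : IsTotallySingular M) (hMn : finrank K M = n)
    (hN : IsTotallySingular N) (hNn : finrank K N = n) (hMN : finrank K ↥(M ⊓ N) + 1 = n) :
    IsPlusClass n K M ↔ ¬ IsPlusClass n K N := by
  set E := baseD n K with hE
  have hEs : IsTotallySingular E := isTotallySingular_baseD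
  have hEn : finrank K E = n := finrank_baseD
  set W := M ⊓ N with hW
  have hA := finrank_inf_perpD hEs hEn hMN
  -- the dimensions of `M ⊓ E`, `N ⊓ E` if `M` contains a vector of `E ⊓ W^⊥` outside `W`
  have key : ∀ {M N : Submodule K (Fin n × Fin 2 → K)}, IsTotallySingular M → finrank K M = n →
      IsTotallySingular N → M ⊓ N = W → ∀ x ∈ E ⊓ perpD W, x ∈ M → x ∉ W →
      finrank K ↥(M ⊓ E) = finrank K ↥(E ⊓ W) + 1 ∧
        finrank K ↥(N ⊓ E) = finrank K ↥(E ⊓ W) := by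
    intro M N hM hMn hN hMN x hx hxM hxW
    have hWM : W ≤ M := hMN ▸ inf_le_left
    have hWN : W ≤ N := hMN ▸ inf_le_right
    -- M = M^⊥ = W^⊥ ∩ x^⊥, and vectors of E are orthogonal to x because x lies in E.
    have hle : E ⊓ perpD W ≤ M := by
      intro y hy
      rw [← hM.perpD_eq hMn, ← hyperplane_sup_span_singleton hWM ‹_› hMn hxM hxW, perpD_sup]
      refine ⟨hy.2, fun z hz => ?_⟩
      obtain ⟨c, rfl⟩ := Submodule.mem_span_singleton.1 hz
      change bilD n K (c • x) y = 0
      rw [map_smul, LinearMap.smul_apply, hEs.bilD_eq_zero hx.1 hy.1, smul_zero]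
    have h1 : M ⊓ E = E ⊓ perpD W :=
      le_antisymm (fun y hy => ⟨hy.2, perpD_anti hWM (hM.le_perpD hy.1)⟩)
        (le_inf hle inf_le_left)
    have h2 : N ⊓ E = E ⊓ W := by
      refine le_antisymm (fun y hy => ⟨hy.2, ?_⟩) (fun y hy => ⟨hWN hy.2, hy.1⟩)
      rw [← hMN]
      exact ⟨hle ⟨hy.2, perpD_anti hWN (hN.le_perpD hy.1)⟩, hy.1⟩
    rw [h1, h2]
    exact ⟨hA, rfl⟩
  obtain ⟨x, hx, hxW⟩ : ∃ x ∈ E ⊓ perpD W, x ∉ W := by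
    by_contra! h
    have : finrank K ↥(E ⊓ perpD W) ≤ finrank K ↥(E ⊓ W) :=
      Submodule.finrank_mono fun y hy => ⟨hy.1, h y hy⟩
    omega
  have hsup : M ⊔ N = perpD W := by
    refine Submodule.eq_of_le_of_finrank_eq (sup_le
      (hM.le_perpD.trans (perpD_anti inf_le_left)) (hN.le_perpD.trans (perpD_anti inf_le_right))) ?_
    have := Submodule.finrank_sup_add_finrank_inf_eq M N
    rw [← hW] at this
    rw [finrank_perpD]
    omega
  -- A singular vector of W^⊥ = M + N lies in M or N: for x = m + m', q(x) = 0 forces m ⊥ m'; if m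
  -- is outside W then m' is orthogonal to W + ⟨m⟩ = M, hence in M. The one of M, N that contains x
  -- meets E in one dimension more than the other, which flips the parity.
  have hcases : x ∈ M ∨ x ∈ N := by
    obtain ⟨m, hm, m', hm', rfl⟩ := Submodule.mem_sup.1 (hsup.ge hx.2)
    by_cases hmW : m ∈ W
    · exact Or.inr (N.add_mem hmW.2 hm')
    · left
      refine M.add_mem hm ?_
      have hq := hEs _ hx.1
      rw [quadD_add, hM m hm, hN m' hm', zero_add, zero_add] at hq
      rw [← hM.perpD_eq hMn, ← hyperplane_sup_span_singleton (W := W) inf_le_left hMN hMn hm hmW,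
        perpD_sup]
      refine ⟨perpD_anti inf_le_right (hN.le_perpD hm'), fun z hz => ?_⟩
      obtain ⟨c, rfl⟩ := Submodule.mem_span_singleton.1 hz
      change bilD n K (c • m) m' = 0
      rw [map_smul, LinearMap.smul_apply, hq, smul_zero]
  have hlt : finrank K ↥(E ⊓ W) + 1 ≤ n := by
    have : finrank K ↥(E ⊓ W) ≤ finrank K W := Submodule.finrank_mono inf_le_right
    omega
  unfold IsPlusClass
  rw [← hE, Nat.even_sub (by have := Submodule.finrank_mono (inf_le_left : M ⊓ E ≤ M); omega),
    Nat.even_sub (by have := Submodule.finrank_mono (inf_le_left : N ⊓ E ≤ N); omega)]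
  rcases hcases with h | h
  · obtain ⟨h1, h2⟩ := key hM hMn hN rfl x hx h hxW
    rw [h1, h2, Nat.even_add_one]
    tauto
  · obtain ⟨h1, h2⟩ := key hN hNn hM (inf_comm N M) x hx h hxW
    rw [h1, h2, Nat.even_add_one]
    tauto

/-- Distinct maximal totally singular subspaces in the same class meet in codimension at least 2. -/
theorem finrank_inf_add_two_le (hM : IsTotallySingular M) (hMn : finrank K M = n)
    (hN : IsTotallySingular N) (hNn : finrank K N = n)
    (h : IsPlusClass n K M ↔ IsPlusClass n K N) (hne : M ≠ N) :
    finrank K ↥(M ⊓ N) + 2 ≤ n := by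
  have h1 := finrank_inf_lt hMn hNn hne
  by_contra h2
  have := isPlusClass_iff_not hM hMn hN hNn (by omega)
  tauto

end Hyperplane

/-! ### Rational totally singular subspaces -/

section Rational

variable {K₀ : Subfield K}

/-- Expand the coordinates in a K₀-basis (b_k) of K: x is the sum of the b_k times the image of x
under the k-th coordinate functional. -/
theorem mem_span_functional {ι : Type*} [Finite ι] (x : ι → K) :
    x ∈ Submodule.span K (Set.range fun φ : K →ₗ[K₀] K₀ => fun i => (φ (x i) : K)) := by
  classical
  cases nonempty_fintype ι
  let b := Basis.ofVectorSpace K₀ K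
  have hx : x = ∑ k ∈ Finset.univ.biUnion fun i => (b.repr (x i)).support,
      b k • fun i => (b.coord k (x i) : K) := by
    ext i
    rw [Finset.sum_apply]
    conv_lhs => rw [← b.linearCombination_repr (x i), Finsupp.linearCombination_apply]
    rw [Finsupp.sum_of_support_subset _
      (Finset.subset_biUnion_of_mem (fun i => (b.repr (x i)).support) (Finset.mem_univ i)) _
      (by simp)]
    refine Finset.sum_congr rfl fun k _ => ?_
    simp [Subfield.smul_def, mul_comm]
  rw [hx]
  refine Submodule.sum_mem _ fun k _ => Submodule.smul_mem _ _ (Submodule.subset_span ?_)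
  rw [← hx]
  exact ⟨b.coord k, rfl⟩

theorem functional_mul (φ : K →ₗ[K₀] K₀) {a : K} (ha : a ∈ K₀) (c : K) :
    (φ (a * c) : K) = a * φ c := by
  have := φ.map_smul (⟨a, ha⟩ : K₀) c
  simpa [Subfield.smul_def] using congrArg (Subtype.val) this

theorem functional_bilD (φ : K →ₗ[K₀] K₀) {w : Fin n × Fin 2 → K} (hw : ∀ p, w p ∈ K₀)
    (x : Fin n × Fin 2 → K) :
    bilD n K w (fun p => (φ (x p) : K)) = φ (bilD n K w x) := by
  simp only [bilD_apply, map_sum, map_add, AddSubmonoidClass.coe_finsetSum, AddMemClass.coe_add,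
    functional_mul φ (hw _)]

variable {U W M N E : Submodule K (Fin n × Fin 2 → K)}

/-- For y in U^⊥, φ(y) is orthogonal to each ψ(u), since that vector has entries in K₀ and φ can be
pulled out of the form; the vectors ψ(u) span u. -/
theorem IsRational.perpD (hU : IsRational K₀ U) : IsRational K₀ (perpD U) := by
  intro φ y hy u hu
  have hle : Submodule.span K (Set.range fun ψ : K →ₗ[K₀] K₀ => fun i => (ψ (u i) : K)) ≤
      LinearMap.ker ((bilD n K).flip fun i => (φ (y i) : K)) := by
    rw [Submodule.span_le]
    rintro _ ⟨ψ, rfl⟩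
    change bilD n K _ _ = 0
    rw [functional_bilD φ (fun p => (ψ (u p)).2), mem_perpD.1 hy _ (hU ψ u hu)]
    simp
  exact hle (mem_span_functional u)

theorem isRational_span_singleton {w : Fin n × Fin 2 → K} (hw : ∀ p, w p ∈ K₀) :
    IsRational K₀ (K ∙ w) :=
  isRational_span (fun c => ⟨c, fun k => mul_comm c k⟩) (by simpa using fun i => hw i)

/-- A maximal totally singular subspace with a rational hyperplane is rational. -/
theorem IsRational.of_hyperplane (hM : IsTotallySingular M) (hMn : finrank K M = n)
    (hW : IsRational K₀ W) (hWM : W ≤ M) (hWn : finrank K W + 1 = n) : IsRational K₀ M := by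
  have hA := finrank_inf_perpD isTotallySingular_baseD (finrank_baseD (n := n) (K := K)) hWn
  -- `W ⊔ A` is one rational maximal totally singular subspace above W. If M is the other one, a
  -- rational vector spanning it modulo W has to be found.
  set A := baseD n K ⊓ _root_.perpD W with hAdef
  have hAs : IsTotallySingular A := isTotallySingular_baseD.mono inf_le_left
  have hAr : IsRational K₀ A := (isRational_baseD K₀).inf hW.perpD
  have hM₁s : IsTotallySingular (W ⊔ A) := (hM.mono hWM).sup hAs inf_le_right
  have hM₁n : finrank K ↥(W ⊔ A) = n := by
    have h1 := Submodule.finrank_sup_add_finrank_inf_eq W A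
    have h2 : W ⊓ A = baseD n K ⊓ W :=
      le_antisymm (fun y hy => ⟨hy.2.1, hy.1⟩)
        fun y hy => ⟨hy.2, hy.1, (hM.mono hWM).le_perpD hy.2⟩
    rw [h2] at h1
    omega
  set M₁ := W ⊔ A with hM₁
  by_cases hle : M ≤ M₁
  · rw [Submodule.eq_of_le_of_finrank_eq hle (hMn.trans hM₁n.symm)]
    exact hW.sup hAr
  obtain ⟨x, hxM, hx⟩ := SetLike.not_le_iff_exists.1 hle
  obtain ⟨φ, hφ⟩ : ∃ φ : K →ₗ[K₀] K₀, (fun i => (φ (x i) : K)) ∉ M₁ := by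
    by_contra! h
    refine hx (Submodule.span_le.2 ?_ (mem_span_functional (K₀ := K₀) x))
    rintro _ ⟨φ, rfl⟩
    exact h φ
  set w := fun i => (φ (x i) : K) with hw
  have hxW : x ∈ _root_.perpD W := perpD_anti hWM (hM.le_perpD hxM)
  have hwW : w ∈ _root_.perpD W := hW.perpD φ x hxW
  have hwK : ∀ p, w p ∈ K₀ := fun p => (φ (x p)).2
  have hM₁W : M₁ ≤ _root_.perpD W := hM₁s.le_perpD.trans (perpD_anti le_sup_left)
  -- M₁ has dimension n and W^⊥ dimension 2n - (n - 1) = n + 1, so w completes M₁ to W^⊥.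
  obtain ⟨m, hm, z, hz, hmz⟩ := Submodule.mem_sup.1 ((hyperplane_sup_span_singleton hM₁W
    (m := n + 1) (by rw [hM₁n]) (by rw [finrank_perpD]; omega) hwW hφ).ge hxW)
  obtain ⟨c, rfl⟩ := Submodule.mem_span_singleton.1 hz
  have hc : c ≠ 0 := by
    rintro rfl
    rw [zero_smul, add_zero] at hmz
    exact hx (hmz ▸ hm)
  -- apply the functional to the coordinates of `x = m + c w`
  have hφm : w = (fun i => (φ (m i) : K)) + (φ c : K) • w := by
    ext i
    have h1 : x i = m i + w i * c := by
      rw [← hmz, Pi.add_apply, Pi.smul_apply, smul_eq_mul, mul_comm]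
    calc w i = (φ (x i) : K) := rfl
      _ = _ := by
        rw [h1, map_add, AddMemClass.coe_add, functional_mul φ (hwK i), Pi.add_apply,
          Pi.smul_apply, smul_eq_mul, mul_comm]
  have hφmM : (fun i => (φ (m i) : K)) ∈ M₁ := (hW.sup hAr) φ m hm
  have hφc : (φ c : K) = 1 := by
    by_contra h
    refine hφ ((M₁.smul_mem_iff (sub_ne_zero.2 (Ne.symm h))).1 ?_)
    have : (1 - (φ c : K)) • w = fun i => (φ (m i) : K) := by
      rw [sub_smul, one_smul, sub_eq_iff_eq_add]
      exact hφm
    rwa [this]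
  have hφm0 : (fun i => (φ (m i) : K)) = 0 := by
    rwa [hφc, one_smul, eq_comm, add_eq_right] at hφm
  have hmw : bilD n K w m = - (quadD n K w * c) := by
    have h := hM x hxM
    rw [← hmz, quadD_add, quadD_smul, hM₁s m hm, map_smul, smul_eq_mul, bilD_comm] at h
    have : c * (bilD n K w m + quadD n K w * c) = 0 := by linear_combination h
    linear_combination (mul_eq_zero.1 this).resolve_left hc
  have hqK : quadD n K w ∈ K₀ := by
    rw [quadD_apply]
    exact sum_mem fun i _ => mul_mem (hwK _) (hwK _)
  -- Apply φ to b(w, m) = -q(w) c: the left side becomes b(w, φ(m)) = 0, the right side -q(w) φ(c) =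
  -- -q(w).
  have hq : quadD n K w = 0 := by
    have h := functional_bilD φ hwK m
    rw [hφm0, map_zero, hmw, map_neg, NegMemClass.coe_neg, functional_mul φ hqK, hφc] at h
    linear_combination h
  have hxWn : x ∉ W := fun h => hx (le_sup_left (a := W) h)
  have hwM : w ∈ M := by
    rw [← hM.perpD_eq hMn, ← hyperplane_sup_span_singleton hWM hWn hMn hxM hxWn, perpD_sup]
    refine ⟨hwW, fun z hz => ?_⟩
    obtain ⟨d, rfl⟩ := Submodule.mem_span_singleton.1 hz
    change bilD n K (d • x) w = 0
    rw [map_smul, LinearMap.smul_apply, ← hmz, map_add, LinearMap.add_apply, map_smul,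
      LinearMap.smul_apply, bilD_self_of_quadD_eq_zero hq, bilD_comm, hmw, hq]
    simp
  rw [← hyperplane_sup_span_singleton hWM hWn hMn hwM fun h => hφ (le_sup_left (a := W) h)]
  exact hW.sup (isRational_span_singleton hwK)

/-- The maximal totally singular subspaces `M` and `N` are such that one of them is rational or
their intersection contains a rational subspace of dimension `n - 2`. -/
def RationalPairD (K₀ : Subfield K) (M N : Submodule K (Fin n × Fin 2 → K)) : Prop :=
  IsRational K₀ M ∨ IsRational K₀ N ∨
    ∃ U, IsRational K₀ U ∧ U ≤ M ⊓ N ∧ finrank K U + 2 = n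

theorem RationalPairD.symm (h : RationalPairD K₀ M N) : RationalPairD K₀ N M := by
  rcases h with h | h | ⟨U, hU, hle, hn⟩
  · exact Or.inr (Or.inl h)
  · exact Or.inl h
  · exact Or.inr (Or.inr ⟨U, hU, inf_comm M N ▸ hle, hn⟩)

variable {M₁ M₂ M₃ Z : Submodule K (Fin n × Fin 2 → K)}

/-- If `M` is rational and `N` has a rational subspace that is not contained in `M`, then the
maximal totally singular subspace `N` that meets `M` in a hyperplane is rational. -/
theorem IsRational.of_adjacent (hM : IsTotallySingular M) (hN : IsTotallySingular N)
    (hNn : finrank K N = n) (hMN : finrank K ↥(M ⊓ N) + 1 = n) (hMr : IsRational K₀ M)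
    (hU : IsRational K₀ U) (hUN : U ≤ N) (hUM : ¬ U ≤ M) : IsRational K₀ N := by
  obtain ⟨x, hxU, hxM⟩ := SetLike.not_le_iff_exists.1 hUM
  have hspan := hyperplane_sup_span_singleton (inf_le_right : M ⊓ N ≤ N) hMN hNn (hUN hxU)
    fun h => hxM h.1
  -- A vector x of U outside M spans N together with M ∩ N, so on M orthogonality to U amounts to
  -- lying in N^⊥ = N. This exhibits the hyperplane M ∩ N of N as rational.
  have hT : M ⊓ _root_.perpD U = M ⊓ N := by
    refine le_antisymm (fun t ht => ⟨ht.1, ?_⟩)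
      (inf_le_inf_left M (hN.le_perpD.trans (perpD_anti hUN)))
    rw [← hN.perpD_eq hNn, ← hspan, perpD_sup]
    refine ⟨perpD_anti inf_le_left (hM.le_perpD ht.1), fun z hz => ?_⟩
    obtain ⟨c, rfl⟩ := Submodule.mem_span_singleton.1 hz
    change bilD n K (c • x) t = 0
    rw [map_smul, LinearMap.smul_apply, mem_perpD.1 ht.2 x hxU, smul_zero]
  exact IsRational.of_hyperplane hN hNn (hT ▸ hMr.inf hU.perpD) inf_le_right hMN

/-- Each combination of witnesses makes N or Z = M₁ ∩ M₂ rational. Two rational Mᵢ give Z. A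
rational M₁ and U ≤ M₂ ∩ N give Z = U if U ≤ M₁, and otherwise N by adjacency. Two witnesses U₁, U₂
are both Z if equal, and otherwise span N or a hyperplane of it. -/
theorem RationalPairD.of_line (hM₁ : IsTotallySingular M₁) (hM₂ : IsTotallySingular M₂)
    (hN : IsTotallySingular N) (hNn : finrank K N = n)
    (h₁ : finrank K ↥(M₁ ⊓ N) + 1 = n) (h₂ : finrank K ↥(M₂ ⊓ N) + 1 = n)
    (hZ : finrank K Z + 2 = n) (h₁₂ : M₁ ⊓ M₂ ≤ Z) (hZ₁ : Z ≤ M₁) (hZ₂ : Z ≤ M₂) (hZ₃ : Z ≤ M₃)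
    (hZN : Z ≤ N) (hr₁ : RationalPairD K₀ M₁ N) (hr₂ : RationalPairD K₀ M₂ N) :
    RationalPairD K₀ M₃ N := by
  have hZr : IsRational K₀ Z → RationalPairD K₀ M₃ N := fun h =>
    Or.inr (Or.inr ⟨Z, h, le_inf hZ₃ hZN, hZ⟩)
  have aux : ∀ {M₁ M₂ : Submodule K (Fin n × Fin 2 → K)}, IsTotallySingular M₁ →
      finrank K ↥(M₁ ⊓ N) + 1 = n → M₁ ⊓ M₂ ≤ Z → IsRational K₀ M₁ →
      ∀ U, IsRational K₀ U → U ≤ M₂ ⊓ N → finrank K U + 2 = n → RationalPairD K₀ M₃ N := by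
    intro M₁ M₂ hM₁ h₁ h₁₂ hr U hU hUN hUn
    by_cases h : U ≤ M₁
    · refine hZr ?_
      rwa [← Submodule.eq_of_le_of_finrank_eq ((le_inf h (hUN.trans inf_le_left)).trans h₁₂)
        (by omega)]
    · exact Or.inr (Or.inl (IsRational.of_adjacent hM₁ hN hNn h₁ hr hU
        (hUN.trans inf_le_right) h))
  rcases hr₁ with hr₁ | hr | ⟨U₁, hU₁, hU₁N, hU₁n⟩
  · rcases hr₂ with hr₂ | hr | ⟨U₂, hU₂, hU₂N, hU₂n⟩
    · exact hZr ((h₁₂.antisymm (le_inf hZ₁ hZ₂)) ▸ hr₁.inf hr₂)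
    · exact Or.inr (Or.inl hr)
    · exact aux hM₁ h₁ h₁₂ hr₁ U₂ hU₂ hU₂N hU₂n
  · exact Or.inr (Or.inl hr)
  · rcases hr₂ with hr₂ | hr | ⟨U₂, hU₂, hU₂N, hU₂n⟩
    · exact aux hM₂ h₂ (inf_comm M₁ M₂ ▸ h₁₂) hr₂ U₁ hU₁ hU₁N hU₁n
    · exact Or.inr (Or.inl hr)
    · by_cases h : U₁ = U₂
      · subst h
        refine hZr ?_
        rwa [← Submodule.eq_of_le_of_finrank_eq ((le_inf (hU₁N.trans inf_le_left)
          (hU₂N.trans inf_le_left)).trans h₁₂) (by omega)]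
      · refine Or.inr (Or.inl ?_)
        have hle : U₁ ⊔ U₂ ≤ N := sup_le (hU₁N.trans inf_le_right) (hU₂N.trans inf_le_right)
        have h1 := finrank_inf_lt (k := finrank K U₁) rfl (by omega) h
        have h2 := Submodule.finrank_sup_add_finrank_inf_eq U₁ U₂
        have h3 := Submodule.finrank_mono hle
        by_cases h4 : finrank K ↥(U₁ ⊔ U₂) = n
        · rw [← Submodule.eq_of_le_of_finrank_eq hle (h4.trans hNn.symm)]
          exact hU₁.sup hU₂
        · exact IsRational.of_hyperplane hN hNn (hU₁.sup hU₂) hle (by omega)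

end Rational

end QuadraticSpace

/-! ### Type D: the invariant subspaces of flags. -/

section TypeD

variable {n : ℕ} {K : Type u} [Field K]

/-- The dimension of the elements of a given type of `D_n(K)`. -/
def NodeD.dim : NodeD n → ℕ
  | .low i => i + 1
  | .plus => n
  | .minus => n

namespace ElemD

theorem finrank_eq (x : ElemD n K) : finrank K x.carrier = x.node.dim := by
  obtain ⟨_ | _ | _, U, hs, hU⟩ := x
  · exact hU
  · exact hU.1
  · exact hU.1

theorem eq_of_carrier_eq {x y : ElemD n K} (h : x.node = y.node) (h' : x.carrier = y.carrier) :
    x = y := by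
  cases x
  cases y
  cases h
  cases h'
  rfl

theorem le_of_inc {x y : ElemD n K} {i : Fin (n - 2)} (hx : x.node = .low i)
    (h : (geometryD n K).Inc x y) (hle : (i : ℕ) + 1 ≤ y.node.dim) : x.carrier ≤ y.carrier := by
  have h' : x.carrier ≤ y.carrier ∨ y.carrier ≤ x.carrier := by
    change IncD x y at h
    unfold IncD at h
    rw [hx] at h
    cases hy : y.node <;> simpa only [hy] using h
  refine h'.elim id fun h => (Submodule.eq_of_le_of_finrank_le h ?_).ge
  rw [x.finrank_eq, y.finrank_eq, hx]
  exact hle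

theorem finrank_inf_of_inc {x y : ElemD n K} (hx : x.node = .plus) (hy : y.node = .minus)
    (h : (geometryD n K).Inc x y) : finrank K ↥(x.carrier ⊓ y.carrier) = n - 1 := by
  change IncD x y at h
  simpa only [IncD, hx, hy] using h

theorem finrank_of_plus {x : ElemD n K} (hx : x.node = .plus) : finrank K x.carrier = n := by
  rw [x.finrank_eq, hx]
  rfl

theorem finrank_of_minus {x : ElemD n K} (hx : x.node = .minus) : finrank K x.carrier = n := by
  rw [x.finrank_eq, hx]
  rfl

theorem finrank_inf_of_plus {x y : ElemD n K} (hx : x.node = .plus) (hy : y.node = .plus)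
    (hne : x ≠ y) : finrank K ↥(x.carrier ⊓ y.carrier) + 2 ≤ n := by
  have h1 := x.hasType
  have h2 := y.hasType
  rw [hx] at h1
  rw [hy] at h2
  exact finrank_inf_add_two_le x.singular h1.1 y.singular h2.1 (iff_of_true h1.2 h2.2)
    fun h => hne (eq_of_carrier_eq (hx.trans hy.symm) h)

theorem finrank_inf_of_minus {x y : ElemD n K} (hx : x.node = .minus) (hy : y.node = .minus)
    (hne : x ≠ y) : finrank K ↥(x.carrier ⊓ y.carrier) + 2 ≤ n := by
  have h1 := x.hasType
  have h2 := y.hasType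
  rw [hx] at h1
  rw [hy] at h2
  exact finrank_inf_add_two_le x.singular h1.1 y.singular h2.1 (iff_of_false h1.2 h2.2)
    fun h => hne (eq_of_carrier_eq (hx.trans hy.symm) h)

end ElemD

/-- Some rational subspace lies between the elements `x` and `y` of `D_n(K)`. -/
def RationalBetweenD (K₀ : Subfield K) (x y : (geometryD n K).Elem) : Prop :=
  ∃ U, IsRational K₀ U ∧ ElemD.carrier x ≤ U ∧ U ≤ ElemD.carrier y

/-- The argument is that of type A. It needs i + 1 to be a node of the path, and `hinf` makes z the
full intersection of y₁ and y₂; for j = ± the latter holds because distinct members of one class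
meet in dimension at most n - 2. -/
theorem isSubspace_rationalBetweenD (K₀ : Subfield K) {J : Set (NodeD n)} {i i' j' : Fin (n - 2)}
    {j : NodeD n} (hi : NodeD.low i ∈ J) (hj : j ∈ J) (hij : NodeD.low i ≠ j)
    (hi' : (i : ℕ) + 1 = i') (hj' : (diagramD n).Adj j (.low j'))
    (hj'j : (j' : ℕ) + 1 ≤ j.dim)
    (hinf : ∀ y₁ y₂ : ElemD n K, y₁.node = j → y₂.node = j → y₁ ≠ y₂ →
      finrank K ↥(y₁.carrier ⊓ y₂.carrier) ≤ j' + 1) :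
    ((geometryD n K).grassmannian (diagramD n) J).IsSubspace
      ((geometryD n K).flagsWith (diagramD n) J (.low i) j (RationalBetweenD K₀)) := by
  refine IncidenceGeometry.isSubspace_flagsWith hi hj hij
    (show (diagramD n).Adj (.low i) (.low i') from Or.inl hi') hj' _ ?_ ?_
  · rintro (x₁ : ElemD n K) (x₂ : ElemD n K) (x₃ : ElemD n K) (y : ElemD n K) (z : ElemD n K)
      (h₁ : x₁.node = .low i) (h₂ : x₂.node = .low i) (h₃ : x₃.node = .low i) (hy : y.node = j)
      (hz : z.node = .low i') hne h₁z h₂z h₃z hyz - - - ⟨U₁, hU₁, hxU₁, hUy₁⟩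
      ⟨U₂, hU₂, hxU₂, hUy₂⟩
    have hiz : (i : ℕ) + 1 ≤ z.node.dim := by
      rw [hz]
      simp only [NodeD.dim]
      omega
    have hzx : z.carrier ≤ x₁.carrier ⊔ x₂.carrier := by
      refine le_sup_of_finrank_succ (ElemD.le_of_inc h₁ h₁z hiz)
        (ElemD.le_of_inc h₂ h₂z hiz) (k := i + 1) (by rw [x₁.finrank_eq, h₁]; rfl)
        (by rw [x₂.finrank_eq, h₂]; rfl)
        (by rw [z.finrank_eq, hz]; simp only [NodeD.dim]; omega)
        fun h => hne (ElemD.eq_of_carrier_eq (h₁.trans h₂.symm) h)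
    exact ⟨U₁ ⊔ U₂, hU₁.sup hU₂, (ElemD.le_of_inc h₃ h₃z hiz).trans
      (hzx.trans (sup_le_sup hxU₁ hxU₂)), sup_le hUy₁ hUy₂⟩
  · rintro (y₁ : ElemD n K) (y₂ : ElemD n K) (y₃ : ElemD n K) (x : ElemD n K) (z : ElemD n K)
      (h₁ : y₁.node = j) (h₂ : y₂.node = j) (h₃ : y₃.node = j) (hx : x.node = .low i)
      (hz : z.node = .low j') hne h₁z h₂z h₃z hxz - - - ⟨U₁, hU₁, hxU₁, hUy₁⟩
      ⟨U₂, hU₂, hxU₂, hUy₂⟩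
    have hle : ∀ {y : ElemD n K}, y.node = j → (geometryD n K).Inc y z →
        z.carrier ≤ y.carrier := fun hy h =>
      ElemD.le_of_inc hz ((geometryD n K).inc_symm _ _ h) (hy ▸ hj'j)
    have hyz : y₁.carrier ⊓ y₂.carrier ≤ z.carrier := by
      refine inf_le_of_finrank_le (hle h₁ h₁z) (hle h₂ h₂z) ?_
      rw [z.finrank_eq, hz]
      exact hinf y₁ y₂ h₁ h₂ hne
    exact ⟨U₁ ⊓ U₂, hU₁.inf hU₂, le_inf hxU₁ hxU₂,
      (inf_le_inf hUy₁ hUy₂).trans (hyz.trans (hle h₃ h₃z))⟩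

theorem isSubspace_rationalPairD (hn : 3 ≤ n) (K₀ : Subfield K) {J : Set (NodeD n)}
    (hi : NodeD.plus ∈ J) (hj : NodeD.minus ∈ J) :
    ((geometryD n K).grassmannian (diagramD n) J).IsSubspace
      ((geometryD n K).flagsWith (diagramD n) J .plus .minus
        fun x y => RationalPairD K₀ (ElemD.carrier x) (ElemD.carrier y)) := by
  let k : Fin (n - 2) := ⟨n - 3, by omega⟩
  have hk : (k : ℕ) + 1 = n - 2 := by simp only [k]; omega
  have dim_z : ∀ {z : ElemD n K}, z.node = .low k → finrank K z.carrier + 2 = n := by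
    intro z hz
    rw [z.finrank_eq, hz]
    simp only [NodeD.dim]
    omega
  have hplus : (k : ℕ) + 1 ≤ NodeD.dim (.plus : NodeD n) := by simp only [NodeD.dim]; omega
  have hminus : (k : ℕ) + 1 ≤ NodeD.dim (.minus : NodeD n) := by simp only [NodeD.dim]; omega
  have le_plus : ∀ {x z : ElemD n K}, x.node = .plus → z.node = .low k →
      (geometryD n K).Inc x z → z.carrier ≤ x.carrier := fun hx hz h =>
    ElemD.le_of_inc hz ((geometryD n K).inc_symm _ _ h) (hx ▸ hplus)
  have le_minus : ∀ {x z : ElemD n K}, x.node = .minus → z.node = .low k →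
      (geometryD n K).Inc x z → z.carrier ≤ x.carrier := fun hx hz h =>
    ElemD.le_of_inc hz ((geometryD n K).inc_symm _ _ h) (hx ▸ hminus)
  refine IncidenceGeometry.isSubspace_flagsWith hi hj (by simp)
    (show (diagramD n).Adj .plus (.low k) from hk) (show (diagramD n).Adj .minus (.low k) from hk)
    _ ?_ ?_
  · rintro (x₁ : ElemD n K) (x₂ : ElemD n K) (x₃ : ElemD n K) (y : ElemD n K) (z : ElemD n K)
      (h₁ : x₁.node = .plus) (h₂ : x₂.node = .plus) (h₃ : x₃.node = .plus) (hy : y.node = .minus)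
      (hz : z.node = .low k) hne h₁z h₂z h₃z hyz h₁y h₂y - hG₁ hG₂
    have e₁ := ElemD.finrank_inf_of_inc h₁ hy h₁y
    have e₂ := ElemD.finrank_inf_of_inc h₂ hy h₂y
    have e₁₂ := ElemD.finrank_inf_of_plus h₁ h₂ hne
    have ez := dim_z hz
    exact RationalPairD.of_line x₁.singular x₂.singular y.singular (ElemD.finrank_of_minus hy)
      (by omega) (by omega) ez
      (inf_le_of_finrank_le (le_plus h₁ hz h₁z) (le_plus h₂ hz h₂z) (by omega))
      (le_plus h₁ hz h₁z) (le_plus h₂ hz h₂z) (le_plus h₃ hz h₃z) (le_minus hy hz hyz) hG₁ hG₂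
  · rintro (y₁ : ElemD n K) (y₂ : ElemD n K) (y₃ : ElemD n K) (x : ElemD n K) (z : ElemD n K)
      (h₁ : y₁.node = .minus) (h₂ : y₂.node = .minus) (h₃ : y₃.node = .minus)
      (hx : x.node = .plus) (hz : z.node = .low k) hne h₁z h₂z h₃z hxz h₁x h₂x - hG₁ hG₂
    have e₁ := ElemD.finrank_inf_of_inc hx h₁ h₁x
    have e₂ := ElemD.finrank_inf_of_inc hx h₂ h₂x
    rw [inf_comm] at e₁ e₂
    have e₁₂ := ElemD.finrank_inf_of_minus h₁ h₂ hne
    have ez := dim_z hz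
    exact (RationalPairD.of_line y₁.singular y₂.singular x.singular (ElemD.finrank_of_plus hx)
      (by omega) (by omega) ez
      (inf_le_of_finrank_le (le_minus h₁ hz h₁z) (le_minus h₂ hz h₂z) (by omega))
      (le_minus h₁ hz h₁z) (le_minus h₂ hz h₂z) (le_minus h₃ hz h₃z) (le_plus hx hz hxz)
      hG₁.symm hG₂.symm).symm

/-! ### A maximal flag that is far from rational -/

/-- With `eᵢ`, `fᵢ` the basis vectors for the coordinates `(i, 0)`, `(i, 1)`, the vectors
`e₀ + a e₁, e₂, …, eₙ₋₂, f₁ - a f₀`, followed by `eₙ₋₁` for `ε = 0` and `fₙ₋₁` for `ε = 1`. -/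
def chainVecD (n : ℕ) (a : K) (ε : Fin 2) (k : ℕ) (p : Fin n × Fin 2) : K :=
  if k = 0 then
    if p.2 = 0 then if (p.1 : ℕ) = 0 then 1 else if (p.1 : ℕ) = 1 then a else 0 else 0
  else if k + 2 < n then if (p.1 : ℕ) = k + 1 ∧ p.2 = 0 then 1 else 0
  else if k + 1 < n then
    if p.2 = 1 then if (p.1 : ℕ) = 1 then 1 else if (p.1 : ℕ) = 0 then -a else 0 else 0
  else if (p.1 : ℕ) + 1 = n ∧ p.2 = ε then 1 else 0

theorem linearIndependent_of_pivot {ι κ : Type*} [Fintype κ] [DecidableEq κ] {b : κ → ι → K}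
    (p : κ → ι) (h : ∀ k l, b l (p k) = if l = k then 1 else 0) : LinearIndependent K b := by
  rw [Fintype.linearIndependent_iff]
  intro g hg k
  simpa [Finset.sum_apply, h] using congrFun hg (p k)

theorem linearIndependent_chainVecD (hn : 3 ≤ n) (a : K) (ε : Fin 2) {m : ℕ} (hm : m ≤ n) :
    LinearIndependent K fun k : Fin m => chainVecD n a ε k := by
  -- A pivot for each vector: a coordinate where it is 1 and the other vectors vanish.
  let p : Fin m → Fin n × Fin 2 := fun k =>
    if (k : ℕ) = 0 then (⟨0, by omega⟩, 0)
    else if h : (k : ℕ) + 2 < n then (⟨k + 1, by omega⟩, 0)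
    else if (k : ℕ) + 1 < n then (⟨1, by omega⟩, 1)
    else (⟨n - 1, by omega⟩, ε)
  refine linearIndependent_of_pivot p fun k l => ?_
  have hk := k.2
  have hl := l.2
  simp only [p, chainVecD, Fin.ext_iff]
  split_ifs <;> simp_all <;> omega

/-- The span of the first `m` of the vectors `chainVecD`. -/
def spanD (n : ℕ) (a : K) (ε : Fin 2) (m : ℕ) : Submodule K (Fin n × Fin 2 → K) :=
  Submodule.span K (Set.range fun k : Fin m => chainVecD n a ε k)

theorem chainVecD_mem_spanD (a : K) (ε : Fin 2) {k m : ℕ} (h : k < m) :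
    chainVecD n a ε k ∈ spanD n a ε m :=
  Submodule.subset_span ⟨⟨k, h⟩, rfl⟩

theorem finrank_spanD (hn : 3 ≤ n) (a : K) (ε : Fin 2) {m : ℕ} (hm : m ≤ n) :
    finrank K (spanD n a ε m) = m := by
  rw [spanD, finrank_span_eq_card (linearIndependent_chainVecD hn a ε hm), Fintype.card_fin]

theorem chainVecD_eq (a : K) (ε ε' : Fin 2) {k : ℕ} (h : k + 1 < n) :
    chainVecD n a ε k = chainVecD n a ε' k := by
  ext p
  simp [chainVecD, h]

theorem spanD_le (a : K) (ε ε' : Fin 2) {l m : ℕ} (hlm : l ≤ m) (h : l < n ∨ ε = ε') :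
    spanD n a ε l ≤ spanD n a ε' m := by
  refine Submodule.span_le.2 ?_
  rintro _ ⟨k, rfl⟩
  have : chainVecD n a ε k = chainVecD n a ε' k := by
    rcases h with h | rfl
    · exact chainVecD_eq a ε ε' (by omega)
    · rfl
  change chainVecD n a ε k ∈ _
  rw [this]
  exact chainVecD_mem_spanD a ε' (by omega)

/-- The first two equations cancel the first two terms of the quadratic form against each other; the
others kill one factor in each remaining term. -/
theorem equations_of_mem_spanD (hn : 3 ≤ n) (a : K) (ε : Fin 2) {x : Fin n × Fin 2 → K}
    (hx : x ∈ spanD n a ε n) :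
    x (⟨1, by omega⟩, 0) = a * x (⟨0, by omega⟩, 0) ∧
      x (⟨0, by omega⟩, 1) = -(a * x (⟨1, by omega⟩, 1)) ∧
      (∀ i : Fin n, 2 ≤ (i : ℕ) → (i : ℕ) + 1 < n → x (i, 1) = 0) ∧
      ∀ δ, δ ≠ ε → x (⟨n - 1, by omega⟩, δ) = 0 := by
  induction hx using Submodule.span_induction with
  | mem x hx =>
    obtain ⟨k, rfl⟩ := hx
    have hk := k.2
    refine ⟨?_, ?_, fun i hi hi' => ?_, fun δ hδ => ?_⟩ <;> simp only [chainVecD] <;>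
      split_ifs <;> simp_all <;> omega
  | zero => simp
  | add x y _ _ hx hy =>
    obtain ⟨h1, h2, h3, h4⟩ := hx
    obtain ⟨h1', h2', h3', h4'⟩ := hy
    refine ⟨?_, ?_, fun i hi hi' => ?_, fun δ hδ => ?_⟩ <;> rw [Pi.add_apply]
    · rw [h1, h1', Pi.add_apply, mul_add]
    · rw [h2, h2', Pi.add_apply, mul_add, neg_add]
    · rw [h3 i hi hi', h3' i hi hi', add_zero]
    · rw [h4 δ hδ, h4' δ hδ, add_zero]
  | smul c x _ hx =>
    obtain ⟨h1, h2, h3, h4⟩ := hx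
    refine ⟨?_, ?_, fun i hi hi' => ?_, fun δ hδ => ?_⟩ <;> rw [Pi.smul_apply, smul_eq_mul]
    · rw [h1, Pi.smul_apply, smul_eq_mul, mul_left_comm]
    · rw [h2, Pi.smul_apply, smul_eq_mul, mul_neg, mul_left_comm]
    · rw [h3 i hi hi', mul_zero]
    · rw [h4 δ hδ, mul_zero]

theorem isTotallySingular_spanD (hn : 3 ≤ n) (a : K) (ε : Fin 2) :
    IsTotallySingular (spanD n a ε n) := by
  intro x hx
  obtain ⟨h1, h2, h3, h4⟩ := equations_of_mem_spanD hn a ε hx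
  rw [quadD_apply, Finset.sum_eq_add ⟨0, by omega⟩ ⟨1, by omega⟩ (by simp [Fin.ext_iff]) _
    (by simp) (by simp), h1, h2]
  · ring
  · rintro i - ⟨hi0, hi1⟩
    rw [Ne, Fin.ext_iff] at hi0 hi1
    by_cases hi : (i : ℕ) + 1 < n
    · rw [h3 i (by simp only at hi0 hi1; omega) hi, mul_zero]
    · rw [show i = ⟨n - 1, by omega⟩ from Fin.ext (by simp only; omega)]
      by_cases hε : ε = 0
      · rw [h4 1 (by simp [hε]), mul_zero]
      · rw [h4 0 (Ne.symm hε), zero_mul]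

/-- For ε = 0 every spanning vector lies in `baseD` except f₁ - a f₀. Hence this subspace is of type
-, and its neighbour with ε = 1 is of type +. -/
theorem finrank_spanD_inf_baseD (hn : 3 ≤ n) (a : K) :
    finrank K ↥(spanD n a 0 n ⊓ baseD n K) + 1 = n := by
  have hM := finrank_spanD hn a 0 le_rfl
  set w := chainVecD n a 0 (n - 2) with hw
  have hw1 : w (⟨1, by omega⟩, 1) = 1 := by
    have h1 : n - 2 ≠ 0 := by omega
    have h2 : ¬ n - 2 + 2 < n := by omega
    have h3 : n - 2 + 1 < n := by omega
    simp [hw, chainVecD, h1, h2, h3]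
  have hw0 : w ≠ 0 := fun h => by simp [h] at hw1
  have hne : spanD n a 0 n ≠ baseD n K := by
    intro h
    have : w ∈ baseD n K := h ▸ chainVecD_mem_spanD a 0 (by omega)
    rw [this] at hw1
    exact zero_ne_one hw1
  have hlt := finrank_inf_lt hM finrank_baseD hne
  have hle : spanD n a 0 n ≤ (spanD n a 0 n ⊓ baseD n K) ⊔ K ∙ w := by
    refine Submodule.span_le.2 ?_
    rintro _ ⟨k, rfl⟩
    by_cases hk : (k : ℕ) = n - 2
    · refine Submodule.mem_sup_right ?_
      change chainVecD n a 0 k ∈ _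
      rw [hk]
      exact Submodule.mem_span_singleton_self w
    · refine Submodule.mem_sup_left ⟨chainVecD_mem_spanD a 0 k.2, fun i => ?_⟩
      have hk' := k.2
      simp only [chainVecD]
      split_ifs <;> first | rfl | omega
  have h1 := Submodule.finrank_mono hle
  have h2 := Submodule.finrank_add_le_finrank_add_finrank (spanD n a 0 n ⊓ baseD n K) (K ∙ w)
  rw [finrank_span_singleton hw0] at h2
  omega

theorem finrank_spanD_inf_spanD (hn : 3 ≤ n) (a : K) :
    finrank K ↥(spanD n a 1 n ⊓ spanD n a 0 n) + 1 = n := by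
  have hne : spanD n a 1 n ≠ spanD n a 0 n := by
    intro h
    have h1 : chainVecD n a 1 (n - 1) ∈ spanD n a 0 n := h ▸ chainVecD_mem_spanD a 1 (by omega)
    have h2 := (equations_of_mem_spanD hn a 0 h1).2.2.2 1 (by simp)
    have h3 : n - 1 ≠ 0 := by omega
    have h4 : ¬ n - 1 + 2 < n := by omega
    have h5 : n - 1 + 1 = n := by omega
    simp [chainVecD, h3, h4, h5] at h2
  have hlt := finrank_inf_lt (finrank_spanD hn a 1 le_rfl) (finrank_spanD hn a 0 le_rfl) hne
  have hle : spanD n a 0 (n - 1) ≤ spanD n a 1 n ⊓ spanD n a 0 n :=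
    le_inf (spanD_le a 0 1 (by omega) (Or.inl (by omega))) (spanD_le a 0 0 (by omega) (Or.inr rfl))
  have h1 := Submodule.finrank_mono hle
  rw [finrank_spanD hn a 0 (by omega)] at h1
  omega

theorem not_isPlusClass_spanD (hn : 3 ≤ n) (a : K) : ¬ IsPlusClass n K (spanD n a 0 n) := by
  have hbase : IsPlusClass n K (baseD n K) := by
    rw [IsPlusClass, inf_idem, finrank_baseD, Nat.sub_self]
    exact Even.zero
  intro h
  exact (isPlusClass_iff_not (isTotallySingular_spanD hn a 0) (finrank_spanD hn a 0 le_rfl)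
    isTotallySingular_baseD finrank_baseD (finrank_spanD_inf_baseD hn a)).1 h hbase

theorem isPlusClass_spanD (hn : 3 ≤ n) (a : K) : IsPlusClass n K (spanD n a 1 n) :=
  (isPlusClass_iff_not (isTotallySingular_spanD hn a 1) (finrank_spanD hn a 1 le_rfl)
    (isTotallySingular_spanD hn a 0) (finrank_spanD hn a 0 le_rfl)
    (finrank_spanD_inf_spanD hn a)).2 (not_isPlusClass_spanD hn a)

/-- The members of a maximal flag of `D_n(K)`. -/
def chainD (hn : 3 ≤ n) (a : K) : NodeD n → ElemD n K
  | .low i =>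
    { node := .low i
      carrier := spanD n a 0 (i + 1)
      singular := (isTotallySingular_spanD hn a 0).mono
        (spanD_le a 0 0 (by omega) (Or.inr rfl))
      hasType := finrank_spanD hn a 0 (by omega) }
  | .plus =>
    { node := .plus
      carrier := spanD n a 1 n
      singular := isTotallySingular_spanD hn a 1
      hasType := ⟨finrank_spanD hn a 1 le_rfl, isPlusClass_spanD hn a⟩ }
  | .minus =>
    { node := .minus
      carrier := spanD n a 0 n
      singular := isTotallySingular_spanD hn a 0
      hasType := ⟨finrank_spanD hn a 0 le_rfl, not_isPlusClass_spanD hn a⟩ }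

theorem chainD_node (hn : 3 ≤ n) (a : K) (t : NodeD n) : (chainD hn a t).node = t := by
  cases t <;> rfl

theorem chainD_inc (hn : 3 ≤ n) (a : K) (s t : NodeD n) :
    (geometryD n K).Inc (chainD hn a s) (chainD hn a t) := by
  change IncD _ _
  have hpm := finrank_spanD_inf_spanD hn a
  have hplus : ∀ i : Fin (n - 2), spanD n a 0 (i + 1) ≤ spanD n a 1 n := fun i =>
    spanD_le a 0 1 (by omega) (Or.inl (by omega))
  have hminus : ∀ i : Fin (n - 2), spanD n a 0 (i + 1) ≤ spanD n a 0 n := fun i =>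
    spanD_le a 0 0 (by omega) (Or.inr rfl)
  rcases s with i | _ | _ <;> rcases t with j | _ | _
  · exact (le_total i j).imp (fun h => spanD_le a 0 0 (Nat.succ_le_succ h) (Or.inr rfl))
      (fun h => spanD_le a 0 0 (Nat.succ_le_succ h) (Or.inr rfl))
  · exact Or.inl (hplus i)
  · exact Or.inl (hminus i)
  · exact Or.inr (hplus j)
  · exact Or.inl le_rfl
  · exact Nat.eq_sub_of_add_eq hpm
  · exact Or.inr (hminus j)
  · change finrank K ↥(spanD n a 0 n ⊓ spanD n a 1 n) = n - 1
    rw [inf_comm]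
    exact Nat.eq_sub_of_add_eq hpm
  · exact Or.inl le_rfl

section NotRational

variable {K₀ : Subfield K} {a : K}

theorem not_isRational_of_mem (hn : 3 ≤ n) (ha : a ∉ K₀) {ε ε' : Fin 2}
    {U : Submodule K (Fin n × Fin 2 → K)} (hv : chainVecD n a ε 0 ∈ U)
    (hU : U ≤ spanD n a ε' n) : ¬ IsRational K₀ U := by
  intro hr
  obtain ⟨φ, h1, ha⟩ := exists_functional_eq_one ha
  have h := (equations_of_mem_spanD hn a ε' (hU (hr φ _ hv))).1
  simp [chainVecD, h1, ha] at h

/-- If some φ(s) were nonzero, a = φ(as)/φ(s) would lie in K₀; and functionals separate s from 0. -/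
theorem eq_zero_of_functional_mul (ha : a ∉ K₀) {s : K}
    (h : ∀ φ : K →ₗ[K₀] K₀, (φ (a * s) : K) = a * φ s) : s = 0 := by
  have h0 : ∀ φ : K →ₗ[K₀] K₀, φ s = 0 := by
    intro φ
    by_contra hφ
    have hφ' : (φ s : K) ≠ 0 := fun h => hφ (Subtype.ext h)
    refine ha ?_
    rw [eq_div_of_mul_eq hφ' (h φ).symm]
    exact div_mem (φ _).2 (φ _).2
  have hmem := mem_span_functional (K₀ := K₀) fun _ : Unit => s
  have hle : Submodule.span K (Set.range fun φ : K →ₗ[K₀] K₀ => fun _ : Unit => (φ s : K)) ≤ ⊥ := by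
    rw [Submodule.span_le]
    rintro _ ⟨φ, rfl⟩
    ext
    simp [h0 φ]
  exact congrFun (hle hmem) ()

theorem not_rationalPairD_spanD (hn : 3 ≤ n) (ha : a ∉ K₀) :
    ¬ RationalPairD K₀ (spanD n a 1 n) (spanD n a 0 n) := by
  rintro (h | h | ⟨U, hU, hUle, hUn⟩)
  · exact not_isRational_of_mem hn ha (chainVecD_mem_spanD a 1 (by omega)) le_rfl h
  · exact not_isRational_of_mem hn ha (chainVecD_mem_spanD a 0 (by omega)) le_rfl h
  have heq : ∀ x ∈ U, x (⟨1, by omega⟩, 0) = a * x (⟨0, by omega⟩, 0) ∧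
      x (⟨0, by omega⟩, 1) = -(a * x (⟨1, by omega⟩, 1)) := fun x hx =>
    let h := equations_of_mem_spanD hn a 1 (hUle hx).1
    ⟨h.1, h.2.1⟩
  -- Both x and φ(x) satisfy the equations with coefficient a, so φ(a s) = a φ(s) for every φ. With
  -- two coordinates forced to vanish on U, adjoining v = e₀ + a e₁ and w = f₁ - a f₀ raises its
  -- dimension to n inside M ∩ N, which has dimension n - 1.
  have h00 : ∀ x ∈ U, x (⟨0, by omega⟩, 0) = 0 := by
    intro x hx
    refine eq_zero_of_functional_mul ha fun φ => ?_
    rw [← (heq x hx).1]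
    exact (heq _ (hU φ x hx)).1
  have h11 : ∀ x ∈ U, x (⟨1, by omega⟩, 1) = 0 := by
    intro x hx
    refine eq_zero_of_functional_mul ha fun φ => ?_
    have h := (heq _ (hU φ x hx)).2
    rw [(heq x hx).2, map_neg, NegMemClass.coe_neg, neg_inj] at h
    exact h
  set v := chainVecD n a 0 0 with hv
  set w := chainVecD n a 0 (n - 2) with hw
  have hv00 : v (⟨0, by omega⟩, 0) = 1 := by simp [hv, chainVecD]
  have hv11 : v (⟨1, by omega⟩, 1) = 0 := by simp [hv, chainVecD]
  have hw11 : w (⟨1, by omega⟩, 1) = 1 := by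
    have h1 : n - 2 ≠ 0 := by omega
    have h2 : ¬ n - 2 + 2 < n := by omega
    have h3 : n - 2 + 1 < n := by omega
    simp [hw, chainVecD, h1, h2, h3]
  have hlt₁ : U < U ⊔ K ∙ v := by
    refine left_lt_sup.2 fun h => ?_
    have := h00 v (h (Submodule.mem_span_singleton_self v))
    rw [hv00] at this
    exact one_ne_zero this
  have hlt₂ : U ⊔ K ∙ v < (U ⊔ K ∙ v) ⊔ K ∙ w := by
    refine left_lt_sup.2 fun h => ?_
    obtain ⟨x, hx, z, hz, hxz⟩ := Submodule.mem_sup.1 (h (Submodule.mem_span_singleton_self w))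
    obtain ⟨c, rfl⟩ := Submodule.mem_span_singleton.1 hz
    rw [← hxz, Pi.add_apply, Pi.smul_apply, h11 x hx, hv11] at hw11
    simp at hw11
  have hmem : ∀ k, k + 1 < n → chainVecD n a 0 k ∈ spanD n a 1 n ⊓ spanD n a 0 n := fun k hk =>
    ⟨chainVecD_eq a 1 0 hk ▸ chainVecD_mem_spanD a 1 (by omega), chainVecD_mem_spanD a 0 (by omega)⟩
  have hle : (U ⊔ K ∙ v) ⊔ K ∙ w ≤ spanD n a 1 n ⊓ spanD n a 0 n := by
    refine sup_le (sup_le hUle ?_) ?_ <;> rw [Submodule.span_singleton_le_iff_mem]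
    · exact hmem 0 (by omega)
    · exact hmem (n - 2) (by omega)
  have h1 := Submodule.finrank_lt_finrank_of_lt hlt₁
  have h2 := Submodule.finrank_lt_finrank_of_lt hlt₂
  have h3 := Submodule.finrank_mono hle
  have h4 := finrank_spanD_inf_spanD hn a
  omega

theorem not_rationalBetweenD_chainD (hn : 3 ≤ n) (ha : a ∉ K₀) (i : Fin (n - 2)) (j : NodeD n) :
    ¬ RationalBetweenD K₀ (chainD hn a (.low i)) (chainD hn a j) := by
  rintro ⟨U, hU, hiU, hUj⟩
  have hv : chainVecD n a 0 0 ∈ U := hiU (chainVecD_mem_spanD a 0 (by omega))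
  rcases j with j | _ | _
  · exact not_isRational_of_mem hn ha hv
      (hUj.trans (spanD_le a 0 0 (by omega) (Or.inr rfl))) hU
  · exact not_isRational_of_mem hn ha hv hUj hU
  · exact not_isRational_of_mem hn ha hv hUj hU

end NotRational

/-- If the flags that contain a rational element of type `i` belong to a subspace of flags that
omits the maximal flags `chainD`, then the generating rank is infinite. -/
theorem aleph0_le_generatingRank_of_flagsWith (hn : 3 ≤ n)
    (hK : ¬ IsFinitelyGeneratedDivisionRing K) {J : Set (NodeD n)} {i j : NodeD n} (hi : i ∈ J)
    (hj : j ∈ J) (G : Subfield K → (geometryD n K).Elem → (geometryD n K).Elem → Prop)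
    (hG : ∀ K₀, ((geometryD n K).grassmannian (diagramD n) J).IsSubspace
      ((geometryD n K).flagsWith (diagramD n) J i j (G K₀)))
    (hrat : ∀ (K₀ : Subfield K) (x y : ElemD n K), x.node = i → y.node = j →
      (geometryD n K).Inc x y → IsRational K₀ x.carrier → G K₀ x y)
    (hchain : ∀ (K₀ : Subfield K) (a : K), a ∉ K₀ → ¬ G K₀ (chainD hn a i) (chainD hn a j)) :
    Cardinal.aleph0 ≤ ((geometryD n K).grassmannian (diagramD n) J).generatingRank := by
  refine PointLineGeometry.aleph0_le_generatingRank _ fun X hX => ?_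
  have hX' : ∀ P : ((geometryD n K).grassmannian (diagramD n) J).Point,
      ∃ x : ElemD n K, x ∈ P.1 ∧ x.node = i := fun P => P.2.exists_mem hi
  choose c hc hci using hX'
  obtain ⟨K₀, hK₀, hr⟩ := exists_subfield_isRational (R := K) (ι := Fin n × Fin 2)
    (fun c => ⟨c, fun k => mul_comm c k⟩) hK (hX.image fun P => (c P).carrier)
    fun U _ => IsNoetherian.noetherian U
  obtain ⟨a, ha⟩ : ∃ a, a ∉ K₀ := by
    by_contra! h
    exact hK₀ (eq_top_iff.2 fun a _ => h a)
  refine ⟨_, hG K₀, fun P hP => ?_, IncidenceGeometry.flagsWith_ne_univ (chainD hn a)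
    (chainD_node hn a) (chainD_inc hn a) (hchain K₀ a ha)⟩
  obtain ⟨y, hy, hyj⟩ := P.2.exists_mem hj
  exact ⟨c P, hc P, y, hy, hci P, hyj, hrat K₀ _ _ (hci P) hyj (P.2.1 _ (hc P) _ hy)
    (hr _ ⟨P, hP, rfl⟩)⟩

theorem aleph0_le_generatingRank_D_low (hn : 3 ≤ n) (hK : ¬ IsFinitelyGeneratedDivisionRing K)
    {J : Set (NodeD n)} {i i' j' : Fin (n - 2)}
    {j : NodeD n} (hi : NodeD.low i ∈ J) (hj : j ∈ J) (hij : NodeD.low i ≠ j)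
    (hi' : (i : ℕ) + 1 = i') (hj' : (diagramD n).Adj j (.low j')) (hi'j : (i' : ℕ) + 1 ≤ j.dim)
    (hj'j : (j' : ℕ) + 1 ≤ j.dim)
    (hinf : ∀ y₁ y₂ : ElemD n K, y₁.node = j → y₂.node = j → y₁ ≠ y₂ →
      finrank K ↥(y₁.carrier ⊓ y₂.carrier) ≤ j' + 1) :
    Cardinal.aleph0 ≤ ((geometryD n K).grassmannian (diagramD n) J).generatingRank := by
  refine aleph0_le_generatingRank_of_flagsWith hn hK hi hj RationalBetweenD
    (fun K₀ => isSubspace_rationalBetweenD K₀ hi hj hij hi' hj' hj'j hinf)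
    (fun K₀ x y hx hy hxy hr => ⟨_, hr, le_rfl, ElemD.le_of_inc hx hxy ?_⟩)
    fun K₀ a ha => not_rationalBetweenD_chainD hn ha i j
  rw [hy]
  omega

theorem aleph0_le_generatingRank_D (hn : 3 ≤ n) (hK : ¬ IsFinitelyGeneratedDivisionRing K)
    {J : Set (NodeD n)} {i j : NodeD n} (hi : i ∈ J) (hj : j ∈ J) (hij : i ≠ j)
    (hadj : ¬ (diagramD n).Adj i j) :
    Cardinal.aleph0 ≤ ((geometryD n K).grassmannian (diagramD n) J).generatingRank := by
  have low_low : ∀ {i j : Fin (n - 2)}, NodeD.low i ∈ J → NodeD.low j ∈ J → i < j →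
      Cardinal.aleph0 ≤ ((geometryD n K).grassmannian (diagramD n) J).generatingRank := by
    intro i j hi hj hij
    have hij' : (i : ℕ) < j := hij
    refine aleph0_le_generatingRank_D_low hn hK hi hj (by simpa using hij.ne)
      (i' := ⟨i + 1, by omega⟩) (j' := ⟨j - 1, by omega⟩) rfl (Or.inr ?_) ?_ ?_
      fun y₁ y₂ h₁ h₂ hne => ?_
    · simp only
      omega
    · simp only [NodeD.dim]
      omega
    · simp only [NodeD.dim]
      omega
    · have := finrank_inf_lt (k := j + 1) (by rw [y₁.finrank_eq, h₁]; rfl)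
        (by rw [y₂.finrank_eq, h₂]; rfl)
        fun h => hne (ElemD.eq_of_carrier_eq (h₁.trans h₂.symm) h)
      simp only
      omega
  have low_plus : ∀ {i : Fin (n - 2)}, NodeD.low i ∈ J → NodeD.plus ∈ J → (i : ℕ) + 1 ≠ n - 2 →
      Cardinal.aleph0 ≤ ((geometryD n K).grassmannian (diagramD n) J).generatingRank := by
    intro i hi hj hne
    -- Indices of `low` start at 0, so `n - 3` is the node n - 2. Non-adjacency of i to + is what
    -- makes i + 1 again a node of the path.
    refine aleph0_le_generatingRank_D_low hn hK hi hj (by simp)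
      (i' := ⟨i + 1, by omega⟩) (j' := ⟨n - 3, by omega⟩) rfl
      (show n - 3 + 1 = n - 2 by omega) ?_ ?_ fun y₁ y₂ h₁ h₂ hne => ?_
    · simp only [NodeD.dim]
      omega
    · simp only [NodeD.dim]
      omega
    · have := ElemD.finrank_inf_of_plus h₁ h₂ hne
      simp only
      omega
  have low_minus : ∀ {i : Fin (n - 2)}, NodeD.low i ∈ J → NodeD.minus ∈ J → (i : ℕ) + 1 ≠ n - 2 →
      Cardinal.aleph0 ≤ ((geometryD n K).grassmannian (diagramD n) J).generatingRank := by
    intro i hi hj hne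
    refine aleph0_le_generatingRank_D_low hn hK hi hj (by simp)
      (i' := ⟨i + 1, by omega⟩) (j' := ⟨n - 3, by omega⟩) rfl
      (show n - 3 + 1 = n - 2 by omega) ?_ ?_ fun y₁ y₂ h₁ h₂ hne => ?_
    · simp only [NodeD.dim]
      omega
    · simp only [NodeD.dim]
      omega
    · have := ElemD.finrank_inf_of_minus h₁ h₂ hne
      simp only
      omega
  have plus_minus : NodeD.plus ∈ J → NodeD.minus ∈ J →
      Cardinal.aleph0 ≤ ((geometryD n K).grassmannian (diagramD n) J).generatingRank :=
    fun hi hj => aleph0_le_generatingRank_of_flagsWith hn hK hi hj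
      (fun K₀ x y => RationalPairD K₀ (ElemD.carrier x) (ElemD.carrier y))
      (fun K₀ => isSubspace_rationalPairD hn K₀ hi hj) (fun K₀ x y _ _ _ hr => Or.inl hr)
      fun K₀ a ha => not_rationalPairD_spanD hn ha
  rcases i with i | _ | _ <;> rcases j with j | _ | _
  · rcases lt_or_gt_of_ne (fun h : i = j => hij (h ▸ rfl)) with h | h
    · exact low_low hi hj h
    · exact low_low hj hi h
  · exact low_plus hi hj hadj
  · exact low_minus hi hj hadj
  · exact low_plus hj hi hadj
  · exact absurd rfl hij
  · exact plus_minus hi hj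
  · exact low_minus hj hi hadj
  · exact plus_minus hj hi
  · exact absurd rfl hij

end TypeD

theorem lemma1p4 :
    (∀ (K : Type*) [DivisionRing K] (n : ℕ) (J : Set (Fin n)),
      ¬ IsFinitelyGeneratedDivisionRing K → ¬ IsConnectedNodeSet (diagramA n) J →
        Cardinal.aleph0 ≤ ((geometryA n K).grassmannian (diagramA n) J).generatingRank) ∧
    (∀ (K : Type*) [Field K] (n : ℕ) (J : Set (NodeD n)), 3 ≤ n →
      ¬ IsFinitelyGeneratedDivisionRing K → ¬ IsConnectedNodeSet (diagramD n) J →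
        Cardinal.aleph0 ≤ ((geometryD n K).grassmannian (diagramD n) J).generatingRank) := by
  refine ⟨fun K _ n J hK hJ => ?_, fun K _ n J hn hK hJ => ?_⟩
  · obtain ⟨i, hi, j, hj, hij, -⟩ := exists_not_adj_of_not_isConnectedNodeSet hJ
    rcases lt_or_gt_of_ne hij with h | h
    · exact aleph0_le_generatingRank_A hK hi hj h
    · exact aleph0_le_generatingRank_A hK hj hi h
  · obtain ⟨i, hi, j, hj, hij, hadj⟩ := exists_not_adj_of_not_isConnectedNodeSet hJ
    exact aleph0_le_generatingRank_D hn hK hi hj hij hadj
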